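/- \textbf{Calculus.} Propositions are built from $\mathbf 1$, $A\multimap B$ and $A\oplus B$. Proof-terms (modulo $\alpha$-equivalence, with $a\in\mathbb C$) are $$t ::= x \mid t + t \mid a\bullet t \mid a.\star \mid \delta_{1}(t,t)\mid \lambda x.t\mid t\,t\mid \mathrm{inl}(t)\mid \mathrm{inr}(t)\mid \mathrm{inlr}(t,t)\mid \delta_\oplus(t,x.t,y.t).$$ The typing rules are linear; contexts are finite and unordered, and $\Gamma,\Delta$ is a disjoint union: $x{:}A\vdash x{:}A$; $\ \vdash a.\star:\mathbf 1$; from $\Gamma\vdash t:A$ and $\Gamma\vdash u:A$ infer $\Gamma\vdash t+u:A$; from $\Gamma\vdash t:A$ infer $\Gamma\vdash a\bullet t:A$; from $\Gamma\vdash t:\mathbf 1$ and $\Delta\vdash u:A$ infer $\Gamma,\Delta\vdash\delta_1(t,u):A$; from $\Gamma,x{:}A\vdash t:B$ infer $\Gamma\vdash\lambda x.t:A\multimap B$; from $\Gamma\vdash t:A\multimap B$ and $\Delta\vdash u:A$ infer $\Gamma,\Delta\vdash t\,u:B$; from $\Gamma\vdash t:A$ infer $\Gamma\vdash\mathrm{inl}(t):A\oplus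 B$; from $\Gamma\vdash t:B$ infer $\Gamma\vdash\mathrm{inr}(t):A\oplus B$; from $\Gamma\vdash t:A$ and $\Gamma\vdash u:B$ infer $\Gamma\vdash\mathrm{inlr}(t,u):A\oplus B$; from $\Gamma\vdash t:A\oplus B$, $\Delta,x{:}A\vdash u:C$ and $\Delta,y{:}B\vdash v:C$ infer $\Gamma,\Delta\vdash\delta_\oplus(t,x.u,y.v):C$. Reduction $\longrightarrow$ is the closure, under all contexts (including under binders), of the following rules, where $(u/x)t$ is capture-avoiding substitution: $\delta_1(a.\star,t)\to a\bullet t$; $(\lambda x.t)\,u\to(u/x)t$; $\delta_\oplus(\mathrm{inl}(t),x.v,y.w)\to(t/x)v$; $\delta_\oplus(\mathrm{inr}(u),x.v,y.w)\to(u/y)w$; $\delta_\oplus(\mathrm{inlr}(t,u),x.v,y.w)\to(t/x)v+(u/y)w$; $a.\star+b.\star\to(a+b).\star$; $\lambda x.t+\lambda x.u\to\lambda x.(t+u)$; $\mathrm{inl}(t)+\mathrm{inl}(v)\to\mathrm{inl}(t+v)$; $\mathrm{inl}(t)+\mathrm{inr}(w)\to\mathrm{inlr}(t,w)$; $\mathrm{inl}(t)+\mathrm{inlr}(v,w)\to\mathrm{inlr}(t+v,w)$;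 $\mathrm{inr}(u)+\mathrm{inl}(v)\to\mathrm{inlr}(v,u)$; $\mathrm{inr}(u)+\mathrm{inr}(w)\to\mathrm{inr}(u+w)$; $\mathrm{inr}(u)+\mathrm{inlr}(v,w)\to\mathrm{inlr}(v,u+w)$; $\mathrm{inlr}(t,u)+\mathrm{inl}(v)\to\mathrm{inlr}(t+v,u)$; $\mathrm{inlr}(t,u)+\mathrm{inr}(w)\to\mathrm{inlr}(t,u+w)$; $\mathrm{inlr}(t,u)+\mathrm{inlr}(v,w)\to\mathrm{inlr}(t+v,u+w)$; $a\bullet b.\star\to(ab).\star$; $a\bullet\lambda x.t\to\lambda x.(a\bullet t)$; $a\bullet\mathrm{inl}(t)\to\mathrm{inl}(a\bullet t)$; $a\bullet\mathrm{inr}(t)\to\mathrm{inr}(a\bullet t)$; $a\bullet\mathrm{inlr}(t,u)\to\mathrm{inlr}(a\bullet t,a\bullet u)$. (This is the quantum in-left-right-calculus without its non-deterministic elimination symbol $\delta_\oplus^{nd}$.) The set $\mathcal V$ of vector propositions is the smallest set containing $\mathbf 1$ and closed under $\oplus$. A closed proof of $A$ is a proof-term $u$ with $\vdash u:A$. A normal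 form of $t$ is an irreducible term $n$ with $t\longrightarrow^* n$. We write $t\equiv u$ when $t$ and $u$ each have exactly one normal form, and these are equal. If $x$ is the only free variable of $t$, we write $t\{u\}$ for $(u/x)t$. \textbf{Theorem (Linearity).} Let $A$ be any proposition, let $B\in\mathcal V$, let $t$ be a proof-term with $x:A\vdash t:B$, let $u_1,u_2$ be closed proofs of $A$, and let $a\in\mathbb C$. Then $$t\{u_1+u_2\}\equiv t\{u_1\}+t\{u_2\}\qquad\text{and}\qquad t\{a\bullet u_1\}\equiv a\bullet t\{u_1\}.$$ -/

import Mathlib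

namespace QILR

/-- Propositions, built from `1`, linear implication and additive disjunction. -/
inductive Prp : Type
  | one : Prp
  | limp : Prp → Prp → Prp
  | oplus : Prp → Prp → Prp

/-- Vector propositions: `1` is one, and so is `A ⊕ B` when `A` and `B` are. -/
inductive IsVec : Prp → Prop
  | one : IsVec Prp.one
  | oplus {A B : Prp} : IsVec A → IsVec B → IsVec (Prp.oplus A B)

/-- Proof-terms of the quantum in-left-right-calculus modulo renaming of bound variables, in
de Bruijn notation: the body of `lam` and each of the last two arguments of `elimPlus` and
`elimPlusND` bind the variable `0`. -/
inductive Tm : Type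
  | var : ℕ → Tm
  /-- the sum of two proofs -/
  | plus : Tm → Tm → Tm
  /-- the product of a scalar and a proof -/
  | scal : ℂ → Tm → Tm
  /-- the introduction of `1` with a scalar -/
  | star : ℂ → Tm
  | elimOne : Tm → Tm → Tm
  | lam : Tm → Tm
  | app : Tm → Tm → Tm
  | inl : Tm → Tm
  | inr : Tm → Tm
  | inlr : Tm → Tm → Tm
  | elimPlus : Tm → Tm → Tm → Tm
  /-- the non-deterministic elimination of the disjunction -/
  | elimPlusND : Tm → Tm → Tm → Tm

namespace Tm

/-- Lift a renaming under a binder. -/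
def upRen (f : ℕ → ℕ) : ℕ → ℕ
  | 0 => 0
  | n + 1 => f n + 1

/-- Renaming of the free variables. -/
def rename : (ℕ → ℕ) → Tm → Tm
  | f, var n => var (f n)
  | f, plus t u => plus (rename f t) (rename f u)
  | f, scal a t => scal a (rename f t)
  | _, star a => star a
  | f, elimOne t u => elimOne (rename f t) (rename f u)
  | f, lam t => lam (rename (upRen f) t)
  | f, app t u => app (rename f t) (rename f u)
  | f, inl t => inl (rename f t)
  | f, inr t => inr (rename f t)
  | f, inlr t u => inlr (rename f t) (rename f u)
  | f, elimPlus t u v =>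
      elimPlus (rename f t) (rename (upRen f) u) (rename (upRen f) v)
  | f, elimPlusND t u v =>
      elimPlusND (rename f t) (rename (upRen f) u) (rename (upRen f) v)

/-- Lift a substitution under a binder. -/
def upSub (s : ℕ → Tm) : ℕ → Tm
  | 0 => var 0
  | n + 1 => rename Nat.succ (s n)

/-- Simultaneous capture-avoiding substitution for the free variables. -/
def subst : (ℕ → Tm) → Tm → Tm
  | s, var n => s n
  | s, plus t u => plus (subst s t) (subst s u)
  | s, scal a t => scal a (subst s t)
  | _, star a => star a
  | s, elimOne t u => elimOne (subst s t) (subst s u)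
  | s, lam t => lam (subst (upSub s) t)
  | s, app t u => app (subst s t) (subst s u)
  | s, inl t => inl (subst s t)
  | s, inr t => inr (subst s t)
  | s, inlr t u => inlr (subst s t) (subst s u)
  | s, elimPlus t u v =>
      elimPlus (subst s t) (subst (upSub s) u) (subst (upSub s) v)
  | s, elimPlusND t u v =>
      elimPlusND (subst s t) (subst (upSub s) u) (subst (upSub s) v)

/-- The substitution sending the variable `0` to `u` and lowering the other variables by one. -/
def single (u : Tm) : ℕ → Tm
  | 0 => u
  | n + 1 => var n

/-- `t.inst u` is `(u/x)t`, where `x` is the variable `0`. -/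
def inst (t u : Tm) : Tm := subst (single u) t

/-- The proof-term does not contain the non-deterministic elimination symbol. -/
def NDFree : Tm → Prop
  | var _ => True
  | plus t u => NDFree t ∧ NDFree u
  | scal _ t => NDFree t
  | star _ => True
  | elimOne t u => NDFree t ∧ NDFree u
  | lam t => NDFree t
  | app t u => NDFree t ∧ NDFree u
  | inl t => NDFree t
  | inr t => NDFree t
  | inlr t u => NDFree t ∧ NDFree u
  | elimPlus t u v => NDFree t ∧ NDFree u ∧ NDFree v
  | elimPlusND _ _ _ => False

end Tm

open Tm

/-- Contexts: a partial map from variables to propositions. (A context in which some proof-term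
is typable always declares finitely many variables.) -/
abbrev Ctx : Type := ℕ → Option Prp

namespace Ctx

/-- The empty context. -/
def empty : Ctx := fun _ => none

/-- The context declaring only the variable `n`, of proposition `A`. -/
def only (n : ℕ) (A : Prp) : Ctx := fun m => if m = n then some A else none

/-- The context `Γ, x : A`, where the new variable `x` is `0` and the others are shifted. -/
def cons (A : Prp) (Γ : Ctx) : Ctx
  | 0 => some A
  | n + 1 => Γ n

/-- `Γ` is the disjoint union of `Γ₁` and `Γ₂`. -/
def Split (Γ Γ₁ Γ₂ : Ctx) : Prop :=
  ∀ n, (Γ₁ n = none ∧ Γ n = Γ₂ n) ∨ (Γ₂ n = none ∧ Γ n = Γ₁ n)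

end Ctx

/-- The (linear) typing rules: `HasType Γ t A` is `Γ ⊢ t : A`. -/
inductive HasType : Ctx → Tm → Prp → Prop
  | ax (n : ℕ) (A : Prp) : HasType (Ctx.only n A) (var n) A
  | sum {Γ : Ctx} {t u : Tm} {A : Prp} :
      HasType Γ t A → HasType Γ u A → HasType Γ (plus t u) A
  | prod {Γ : Ctx} {t : Tm} {A : Prp} (a : ℂ) :
      HasType Γ t A → HasType Γ (scal a t) A
  | oneI (a : ℂ) : HasType Ctx.empty (star a) Prp.one
  | oneE {Γ Γ₁ Γ₂ : Ctx} {t u : Tm} {A : Prp} :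
      Ctx.Split Γ Γ₁ Γ₂ → HasType Γ₁ t Prp.one → HasType Γ₂ u A →
      HasType Γ (elimOne t u) A
  | limpI {Γ : Ctx} {t : Tm} {A B : Prp} :
      HasType (Ctx.cons A Γ) t B → HasType Γ (lam t) (Prp.limp A B)
  | limpE {Γ Γ₁ Γ₂ : Ctx} {t u : Tm} {A B : Prp} :
      Ctx.Split Γ Γ₁ Γ₂ → HasType Γ₁ t (Prp.limp A B) → HasType Γ₂ u A →
      HasType Γ (app t u) B
  | oplusI1 {Γ : Ctx} {t : Tm} {A B : Prp} :
      HasType Γ t A → HasType Γ (inl t) (Prp.oplus A B)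
  | oplusI2 {Γ : Ctx} {t : Tm} {A B : Prp} :
      HasType Γ t B → HasType Γ (inr t) (Prp.oplus A B)
  | oplusI3 {Γ : Ctx} {t u : Tm} {A B : Prp} :
      HasType Γ t A → HasType Γ u B → HasType Γ (inlr t u) (Prp.oplus A B)
  | oplusE {Γ Γ₁ Γ₂ : Ctx} {t u v : Tm} {A B C : Prp} :
      Ctx.Split Γ Γ₁ Γ₂ → HasType Γ₁ t (Prp.oplus A B) →
      HasType (Ctx.cons A Γ₂) u C → HasType (Ctx.cons B Γ₂) v C →
      HasType Γ (elimPlus t u v) C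
  | oplusEND {Γ Γ₁ Γ₂ : Ctx} {t u v : Tm} {A B C : Prp} :
      Ctx.Split Γ Γ₁ Γ₂ → HasType Γ₁ t (Prp.oplus A B) →
      HasType (Ctx.cons A Γ₂) u C → HasType (Ctx.cons B Γ₂) v C →
      HasType Γ (elimPlusND t u v) C

/-- The reduction rules, applied at the root. -/
inductive RootStep : Tm → Tm → Prop
  | one (a : ℂ) (t : Tm) : RootStep (elimOne (star a) t) (scal a t)
  | beta (t u : Tm) : RootStep (app (lam t) u) (t.inst u)
  | caseInl (t v w : Tm) : RootStep (elimPlus (inl t) v w) (v.inst t)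
  | caseInr (u v w : Tm) : RootStep (elimPlus (inr u) v w) (w.inst u)
  | caseInlr (t u v w : Tm) :
      RootStep (elimPlus (inlr t u) v w) (plus (v.inst t) (w.inst u))
  | ndInl (t v w : Tm) : RootStep (elimPlusND (inl t) v w) (v.inst t)
  | ndInr (u v w : Tm) : RootStep (elimPlusND (inr u) v w) (w.inst u)
  | ndInlrLeft (t u v w : Tm) : RootStep (elimPlusND (inlr t u) v w) (v.inst t)
  | ndInlrRight (t u v w : Tm) : RootStep (elimPlusND (inlr t u) v w) (w.inst u)
  | plusStar (a b : ℂ) : RootStep (plus (star a) (star b)) (star (a + b))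
  | plusLam (t u : Tm) : RootStep (plus (lam t) (lam u)) (lam (plus t u))
  | plusInlInl (t v : Tm) : RootStep (plus (inl t) (inl v)) (inl (plus t v))
  | plusInlInr (t w : Tm) : RootStep (plus (inl t) (inr w)) (inlr t w)
  | plusInlInlr (t v w : Tm) : RootStep (plus (inl t) (inlr v w)) (inlr (plus t v) w)
  | plusInrInl (u v : Tm) : RootStep (plus (inr u) (inl v)) (inlr v u)
  | plusInrInr (u w : Tm) : RootStep (plus (inr u) (inr w)) (inr (plus u w))
  | plusInrInlr (u v w : Tm) : RootStep (plus (inr u) (inlr v w)) (inlr v (plus u w))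
  | plusInlrInl (t u v : Tm) : RootStep (plus (inlr t u) (inl v)) (inlr (plus t v) u)
  | plusInlrInr (t u w : Tm) : RootStep (plus (inlr t u) (inr w)) (inlr t (plus u w))
  | plusInlrInlr (t u v w : Tm) :
      RootStep (plus (inlr t u) (inlr v w)) (inlr (plus t v) (plus u w))
  | scalStar (a b : ℂ) : RootStep (scal a (star b)) (star (a * b))
  | scalLam (a : ℂ) (t : Tm) : RootStep (scal a (lam t)) (lam (scal a t))
  | scalInl (a : ℂ) (t : Tm) : RootStep (scal a (inl t)) (inl (scal a t))
  | scalInr (a : ℂ) (t : Tm) : RootStep (scal a (inr t)) (inr (scal a t))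
  | scalInlr (a : ℂ) (t u : Tm) :
      RootStep (scal a (inlr t u)) (inlr (scal a t) (scal a u))

/-- One-step reduction: a reduction rule applied at any position, also under binders. -/
inductive Step : Tm → Tm → Prop
  | root {t t' : Tm} : RootStep t t' → Step t t'
  | plus₁ {t t' u : Tm} : Step t t' → Step (plus t u) (plus t' u)
  | plus₂ {t u u' : Tm} : Step u u' → Step (plus t u) (plus t u')
  | scal {a : ℂ} {t t' : Tm} : Step t t' → Step (scal a t) (scal a t')
  | elimOne₁ {t t' u : Tm} : Step t t' → Step (elimOne t u) (elimOne t' u)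
  | elimOne₂ {t u u' : Tm} : Step u u' → Step (elimOne t u) (elimOne t u')
  | lam {t t' : Tm} : Step t t' → Step (lam t) (lam t')
  | app₁ {t t' u : Tm} : Step t t' → Step (app t u) (app t' u)
  | app₂ {t u u' : Tm} : Step u u' → Step (app t u) (app t u')
  | inl {t t' : Tm} : Step t t' → Step (inl t) (inl t')
  | inr {t t' : Tm} : Step t t' → Step (inr t) (inr t')
  | inlr₁ {t t' u : Tm} : Step t t' → Step (inlr t u) (inlr t' u)
  | inlr₂ {t u u' : Tm} : Step u u' → Step (inlr t u) (inlr t u')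
  | elimPlus₁ {t t' u v : Tm} : Step t t' → Step (elimPlus t u v) (elimPlus t' u v)
  | elimPlus₂ {t u u' v : Tm} : Step u u' → Step (elimPlus t u v) (elimPlus t u' v)
  | elimPlus₃ {t u v v' : Tm} : Step v v' → Step (elimPlus t u v) (elimPlus t u v')
  | elimPlusND₁ {t t' u v : Tm} : Step t t' → Step (elimPlusND t u v) (elimPlusND t' u v)
  | elimPlusND₂ {t u u' v : Tm} : Step u u' → Step (elimPlusND t u v) (elimPlusND t u' v)
  | elimPlusND₃ {t u v v' : Tm} : Step v v' → Step (elimPlusND t u v) (elimPlusND t u v')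

/-- A proof-term is irreducible if no reduction step starts from it. -/
def Irred (t : Tm) : Prop := ∀ t', ¬ Step t t'

/-- `n` is an irreducible form (normal form) of `t`. -/
def IsNormalForm (t n : Tm) : Prop := Relation.ReflTransGen Step t n ∧ Irred n

/-- Equality of normal forms: `t` and `u` have a normal form, it is unique for each of them,
and it is the same for both. -/
def NFEq (t u : Tm) : Prop :=
  ∃ n, (∀ m, IsNormalForm t m ↔ m = n) ∧ (∀ m, IsNormalForm u m ↔ m = n)

end QILR

/-!
The proof is a logical-relations argument that reads proof-terms as linear maps.

Without the non-deterministic rules the reduction rules are left-linear and do not overlap, so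
reduction is confluent (`Par.diamond`). Hence convertibility `Conv` is an equivalence relation that
separates different scalars and different introductions (`Conv.star_inj`, `Conv.mk_inj`), and an
irreducible proof-term convertible to `t` is the unique normal form of `t`
(`isNormalForm_iff_of_conv`).

By recursion on the proposition `A` one defines a partial equivalence relation `LogEq A` on
proof-terms, invariant under conversion: at `1`, having the same scalar as value; at a disjunction,
having introductions of the same kind with related components as values; at an implication, being
abstractions that send related arguments to related results and preserve sums and products by
scalars. Modulo `LogEq A` the proofs of `A` form a commutative semigroup with a linear action of the
scalars (`LogEq.linPER`). The semigroup at a disjunction is obtained from those of its components by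
adjoining a neutral element `none` to each, standing for the component that `inl` or `inr` leaves
out, and by excluding the pair of both neutral elements.

The fundamental theorem `HasType.multilinear` says that a typed proof-term respects `LogEq` and is
linear in each variable of its context. The linear discipline enters in `LinCtx.split`: a variable
goes to exactly one premise of a multiplicative rule. The additive rules need that the operations
commute with one another (`LinLaws.op_comm`). Closed proofs are thus related to themselves, and
`t{u₁ + u₂}` is related to `t{u₁} + t{u₂}`, for every proposition `B`.

Finally, `LogEq B` at a vector proposition `B` means having a common irreducible reduct
(`LogEq.exists_irred`). Strong normalization is not needed: the existence of a normal form comes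
from the relation, its uniqueness from confluence.
-/

namespace QILR

open Relation

namespace Tm

/-! ### Calculus of substitutions -/

/-- The substitution sending `0` to `u` and `n + 1` to `s n`. -/
def scons (u : Tm) (s : ℕ → Tm) : ℕ → Tm
  | 0 => u
  | n + 1 => s n

theorem upRen_comp (f g : ℕ → ℕ) : upRen f ∘ upRen g = upRen (f ∘ g) := by
  funext n; cases n <;> rfl

theorem rename_rename (t : Tm) (f g : ℕ → ℕ) :
    rename f (rename g t) = rename (f ∘ g) t := by
  induction t generalizing f g <;> simp_all [rename, upRen_comp]

theorem upSub_comp_upRen (s : ℕ → Tm) (f : ℕ → ℕ) :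
    upSub s ∘ upRen f = upSub (s ∘ f) := by
  funext n; cases n <;> rfl

theorem subst_rename (t : Tm) (s : ℕ → Tm) (f : ℕ → ℕ) :
    subst s (rename f t) = subst (s ∘ f) t := by
  induction t generalizing s f <;> simp_all [rename, subst, upSub_comp_upRen]

theorem rename_comp_upSub (f : ℕ → ℕ) (s : ℕ → Tm) :
    rename (upRen f) ∘ upSub s = upSub (rename f ∘ s) := by
  funext n
  cases n with
  | zero => rfl
  | succ n =>
    simp only [Function.comp, upSub, rename_rename]
    rfl

theorem rename_subst (t : Tm) (f : ℕ → ℕ) (s : ℕ → Tm) :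
    rename f (subst s t) = subst (rename f ∘ s) t := by
  induction t generalizing s f <;> simp_all [rename, subst, rename_comp_upSub]

theorem subst_comp_upSub (s s' : ℕ → Tm) :
    subst (upSub s) ∘ upSub s' = upSub (subst s ∘ s') := by
  funext n
  cases n with
  | zero => rfl
  | succ n =>
    simp only [Function.comp, upSub, rename_subst, subst_rename]
    rfl

theorem subst_subst (t : Tm) (s s' : ℕ → Tm) :
    subst s (subst s' t) = subst (subst s ∘ s') t := by
  induction t generalizing s s' <;> simp_all [subst, subst_comp_upSub]

theorem upSub_var : upSub var = var := by
  funext n; cases n <;> rfl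

theorem subst_var (t : Tm) : subst var t = t := by
  induction t <;> simp_all [subst, upSub_var]

theorem subst_single_comp_upSub (u : Tm) (s : ℕ → Tm) :
    subst (single u) ∘ upSub s = scons u s := by
  funext n
  cases n with
  | zero => rfl
  | succ n =>
    simp only [Function.comp, upSub, subst_rename, scons]
    exact subst_var _

theorem inst_subst_upSub (t u : Tm) (s : ℕ → Tm) :
    (subst (upSub s) t).inst u = subst (scons u s) t := by
  rw [inst, subst_subst, subst_single_comp_upSub]

theorem subst_inst (t u : Tm) (s : ℕ → Tm) :
    subst s (t.inst u) = (subst (upSub s) t).inst (subst s u) := by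
  rw [inst_subst_upSub, inst, subst_subst]
  congr 1
  funext n; cases n <;> rfl

end Tm

open Tm

theorem RootStep.subst {t r : Tm} (h : RootStep t r) (s : ℕ → Tm) :
    RootStep (t.subst s) (r.subst s) := by
  cases h <;> simp only [Tm.subst, subst_inst] <;> constructor

/-! ### Parallel reduction and the Church–Rosser property -/

/-- Parallel reduction, without the rules of the non-deterministic elimination symbol. The
immediate subterms are reduced first, and the outcome may then be contracted at the root, even if
the redex has only just been created. -/
inductive Par : Tm → Tm → Prop
  | var (n : ℕ) : Par (var n) (var n)
  | star (a : ℂ) : Par (star a) (star a)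
  | plus {t t' u u' : Tm} : Par t t' → Par u u' → Par (plus t u) (plus t' u')
  | scal {t t' : Tm} (a : ℂ) : Par t t' → Par (scal a t) (scal a t')
  | elimOne {t t' u u' : Tm} : Par t t' → Par u u' → Par (elimOne t u) (elimOne t' u')
  | lam {t t' : Tm} : Par t t' → Par (lam t) (lam t')
  | app {t t' u u' : Tm} : Par t t' → Par u u' → Par (app t u) (app t' u')
  | inl {t t' : Tm} : Par t t' → Par (inl t) (inl t')
  | inr {t t' : Tm} : Par t t' → Par (inr t) (inr t')
  | inlr {t t' u u' : Tm} : Par t t' → Par u u' → Par (inlr t u) (inlr t' u')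
  | elimPlus {t t' u u' v v' : Tm} : Par t t' → Par u u' → Par v v' →
      Par (elimPlus t u v) (elimPlus t' u' v')
  | elimPlusND {t t' u u' v v' : Tm} : Par t t' → Par u u' → Par v v' →
      Par (elimPlusND t u v) (elimPlusND t' u' v')
  | plusRoot {t t' u u' r : Tm} : Par t t' → Par u u' → RootStep (plus t' u') r →
      Par (plus t u) r
  | scalRoot {t t' r : Tm} {a : ℂ} : Par t t' → RootStep (scal a t') r → Par (scal a t) r
  | elimOneRoot {t t' u u' r : Tm} : Par t t' → Par u u' → RootStep (elimOne t' u') r →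
      Par (elimOne t u) r
  | appRoot {t t' u u' r : Tm} : Par t t' → Par u u' → RootStep (app t' u') r →
      Par (app t u) r
  | elimPlusRoot {t t' u u' v v' r : Tm} : Par t t' → Par u u' → Par v v' →
      RootStep (elimPlus t' u' v') r → Par (elimPlus t u v) r

theorem Par.refl (t : Tm) : Par t t := by
  induction t <;> constructor <;> assumption

/-- Parallel reduction is compatible with any class `P` of pairs of pointwise related substitutions
that is closed under lifting. Applied first to renamings, and then, since renaming is what lifting
needs, to all substitutions. -/
theorem Par.subst_of_upSub {P : (ℕ → Tm) → (ℕ → Tm) → Prop}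
    (up : ∀ {s s'}, P s s' → P (upSub s) (upSub s'))
    (par : ∀ {s s'}, P s s' → ∀ n, Par (s n) (s' n))
    {t t' : Tm} (h : Par t t') {s s' : ℕ → Tm} (hs : P s s') :
    Par (t.subst s) (t'.subst s') := by
  induction h generalizing s s' with
  | var n => exact par hs n
  | star a => exact .star a
  | plus _ _ i j => exact .plus (i hs) (j hs)
  | scal a _ i => exact .scal a (i hs)
  | elimOne _ _ i j => exact .elimOne (i hs) (j hs)
  | lam _ i => exact .lam (i (up hs))
  | app _ _ i j => exact .app (i hs) (j hs)
  | inl _ i => exact .inl (i hs)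
  | inr _ i => exact .inr (i hs)
  | inlr _ _ i j => exact .inlr (i hs) (j hs)
  | elimPlus _ _ _ i j k => exact .elimPlus (i hs) (j (up hs)) (k (up hs))
  | elimPlusND _ _ _ i j k => exact .elimPlusND (i hs) (j (up hs)) (k (up hs))
  | plusRoot _ _ r i j => exact .plusRoot (i hs) (j hs) (r.subst s')
  | scalRoot _ r i => exact .scalRoot (i hs) (r.subst s')
  | elimOneRoot _ _ r i j => exact .elimOneRoot (i hs) (j hs) (r.subst s')
  | appRoot _ _ r i j => exact .appRoot (i hs) (j hs) (r.subst s')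
  | elimPlusRoot _ _ _ r i j k =>
    exact .elimPlusRoot (i hs) (j (up hs)) (k (up hs)) (r.subst s')

theorem upSub_var_comp (f : ℕ → ℕ) : upSub (fun n => var (f n)) = fun n => var (upRen f n) := by
  funext n; cases n <;> rfl

theorem rename_eq_subst (t : Tm) (f : ℕ → ℕ) : t.rename f = t.subst (fun n => var (f n)) := by
  induction t generalizing f <;> simp_all [Tm.rename, Tm.subst, upSub_var_comp]

theorem Par.rename {t t' : Tm} (h : Par t t') (f : ℕ → ℕ) : Par (t.rename f) (t'.rename f) := by
  rw [rename_eq_subst, rename_eq_subst]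
  refine h.subst_of_upSub (P := fun s s' => ∃ f : ℕ → ℕ, s = (fun n => Tm.var (f n)) ∧ s' = s)
    ?_ ?_ ⟨f, rfl, rfl⟩
  · rintro _ _ ⟨f, rfl, rfl⟩
    exact ⟨_, upSub_var_comp f, rfl⟩
  · rintro _ _ ⟨f, rfl, rfl⟩ n
    exact .refl _

theorem Par.subst {t t' : Tm} (h : Par t t') {s s' : ℕ → Tm} (hs : ∀ n, Par (s n) (s' n)) :
    Par (t.subst s) (t'.subst s') := by
  refine h.subst_of_upSub (P := fun s s' => ∀ n, Par (s n) (s' n)) ?_ (fun h => h) hs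
  intro s s' hs n
  cases n with
  | zero => exact .var 0
  | succ n => exact (hs n).rename _

theorem Par.inst {t t' u u' : Tm} (h : Par t t') (hu : Par u u') :
    Par (t.inst u) (t'.inst u') := by
  refine h.subst fun n => ?_
  cases n with
  | zero => exact hu
  | succ n => exact .var n

/-! A redex survives the parallel reduction of the immediate subterms, because these are headed by
introduction symbols wherever the redex inspects them, and the contracta are again related. -/

theorem RootStep.par_plus {t t' u u' r : Tm} (h : RootStep (plus t u) r) (ht : Par t t')
    (hu : Par u u') : ∃ r', RootStep (plus t' u') r' ∧ Par r r' := by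
  cases h <;> cases ht <;> cases hu <;>
    exact ⟨_, by constructor, by repeat' first | assumption | constructor⟩

theorem RootStep.par_scal {a : ℂ} {t t' r : Tm} (h : RootStep (scal a t) r) (ht : Par t t') :
    ∃ r', RootStep (scal a t') r' ∧ Par r r' := by
  cases h <;> cases ht <;>
    exact ⟨_, by constructor, by repeat' first | assumption | constructor⟩

theorem RootStep.par_elimOne {t t' u u' r : Tm} (h : RootStep (elimOne t u) r) (ht : Par t t')
    (hu : Par u u') : ∃ r', RootStep (elimOne t' u') r' ∧ Par r r' := by
  cases h; cases ht
  exact ⟨_, .one _ _, .scal _ hu⟩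

theorem RootStep.par_app {t t' u u' r : Tm} (h : RootStep (app t u) r) (ht : Par t t')
    (hu : Par u u') : ∃ r', RootStep (app t' u') r' ∧ Par r r' := by
  cases h; cases ht with | lam ht => exact ⟨_, .beta _ _, ht.inst hu⟩

theorem RootStep.par_elimPlus {t t' u u' v v' r : Tm} (h : RootStep (elimPlus t u v) r)
    (ht : Par t t') (hu : Par u u') (hv : Par v v') :
    ∃ r', RootStep (elimPlus t' u' v') r' ∧ Par r r' := by
  cases h with
  | caseInl => cases ht with | inl ht => exact ⟨_, .caseInl _ _ _, hu.inst ht⟩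
  | caseInr => cases ht with | inr ht => exact ⟨_, .caseInr _ _ _, hv.inst ht⟩
  | caseInlr => cases ht with
    | inlr h k => exact ⟨_, .caseInlr _ _ _ _, .plus (hu.inst h) (hv.inst k)⟩

theorem RootStep.plus_unique {t u r r' : Tm} (h : RootStep (plus t u) r)
    (h' : RootStep (plus t u) r') : r = r' := by
  cases h <;> cases h' <;> rfl

theorem RootStep.scal_unique {a : ℂ} {t r r' : Tm} (h : RootStep (scal a t) r)
    (h' : RootStep (scal a t) r') : r = r' := by
  cases h <;> cases h' <;> rfl

theorem RootStep.elimOne_unique {t u r r' : Tm} (h : RootStep (elimOne t u) r)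
    (h' : RootStep (elimOne t u) r') : r = r' := by
  cases h; cases h'; rfl

theorem RootStep.app_unique {t u r r' : Tm} (h : RootStep (app t u) r)
    (h' : RootStep (app t u) r') : r = r' := by
  cases h; cases h'; rfl

theorem RootStep.elimPlus_unique {t u v r r' : Tm} (h : RootStep (elimPlus t u v) r)
    (h' : RootStep (elimPlus t u v) r') : r = r' := by
  cases h <;> cases h' <;> rfl

/-- Without the non-deterministic rules the reduction rules are left-linear and do not overlap, so
two parallel reductions from the same proof-term can be closed in one step. -/
theorem Par.diamond {t t₁ t₂ : Tm} (h₁ : Par t t₁) (h₂ : Par t t₂) :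
    ∃ t₃, Par t₁ t₃ ∧ Par t₂ t₃ := by
  induction h₁ generalizing t₂ with
  | var n => exact ⟨_, h₂, .refl _⟩
  | star a => exact ⟨_, h₂, .refl _⟩
  | lam _ i =>
    cases h₂ with
    | lam h => obtain ⟨_, a, b⟩ := i h; exact ⟨_, .lam a, .lam b⟩
  | inl _ i =>
    cases h₂ with
    | inl h => obtain ⟨_, a, b⟩ := i h; exact ⟨_, .inl a, .inl b⟩
  | inr _ i =>
    cases h₂ with
    | inr h => obtain ⟨_, a, b⟩ := i h; exact ⟨_, .inr a, .inr b⟩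
  | inlr _ _ i j =>
    cases h₂ with
    | inlr h k =>
      obtain ⟨_, a, b⟩ := i h
      obtain ⟨_, c, d⟩ := j k
      exact ⟨_, .inlr a c, .inlr b d⟩
  | elimPlusND _ _ _ i j k =>
    cases h₂ with
    | elimPlusND h h' h'' =>
      obtain ⟨_, a, b⟩ := i h
      obtain ⟨_, c, d⟩ := j h'
      obtain ⟨_, e, f⟩ := k h''
      exact ⟨_, .elimPlusND a c e, .elimPlusND b d f⟩
  | scal x _ i =>
    cases h₂ with
    | scal _ h =>
      obtain ⟨_, a, b⟩ := i h
      exact ⟨_, .scal x a, .scal x b⟩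
    | scalRoot h r =>
      obtain ⟨_, a, b⟩ := i h
      obtain ⟨_, r', p⟩ := r.par_scal b
      exact ⟨_, .scalRoot a r', p⟩
  | scalRoot _ q i =>
    cases h₂ with
    | scal _ h =>
      obtain ⟨_, a, b⟩ := i h
      obtain ⟨_, r', p⟩ := q.par_scal a
      exact ⟨_, p, .scalRoot b r'⟩
    | scalRoot h r =>
      obtain ⟨_, a, b⟩ := i h
      obtain ⟨_, r₁, p⟩ := q.par_scal a
      obtain ⟨_, r₂, p'⟩ := r.par_scal b
      exact ⟨_, p, r₁.scal_unique r₂ ▸ p'⟩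
  | plus _ _ i j =>
    cases h₂ with
    | plus h k =>
      obtain ⟨_, a, b⟩ := i h
      obtain ⟨_, c, d⟩ := j k
      exact ⟨_, .plus a c, .plus b d⟩
    | plusRoot h k r =>
      obtain ⟨_, a, b⟩ := i h
      obtain ⟨_, c, d⟩ := j k
      obtain ⟨_, r', p⟩ := r.par_plus b d
      exact ⟨_, .plusRoot a c r', p⟩
  | plusRoot _ _ q i j =>
    cases h₂ with
    | plus h k =>
      obtain ⟨_, a, b⟩ := i h
      obtain ⟨_, c, d⟩ := j k
      obtain ⟨_, r', p⟩ := q.par_plus a c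
      exact ⟨_, p, .plusRoot b d r'⟩
    | plusRoot h k r =>
      obtain ⟨_, a, b⟩ := i h
      obtain ⟨_, c, d⟩ := j k
      obtain ⟨_, r₁, p⟩ := q.par_plus a c
      obtain ⟨_, r₂, p'⟩ := r.par_plus b d
      exact ⟨_, p, r₁.plus_unique r₂ ▸ p'⟩
  | elimOne _ _ i j =>
    cases h₂ with
    | elimOne h k =>
      obtain ⟨_, a, b⟩ := i h
      obtain ⟨_, c, d⟩ := j k
      exact ⟨_, .elimOne a c, .elimOne b d⟩
    | elimOneRoot h k r =>
      obtain ⟨_, a, b⟩ := i h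
      obtain ⟨_, c, d⟩ := j k
      obtain ⟨_, r', p⟩ := r.par_elimOne b d
      exact ⟨_, .elimOneRoot a c r', p⟩
  | elimOneRoot _ _ q i j =>
    cases h₂ with
    | elimOne h k =>
      obtain ⟨_, a, b⟩ := i h
      obtain ⟨_, c, d⟩ := j k
      obtain ⟨_, r', p⟩ := q.par_elimOne a c
      exact ⟨_, p, .elimOneRoot b d r'⟩
    | elimOneRoot h k r =>
      obtain ⟨_, a, b⟩ := i h
      obtain ⟨_, c, d⟩ := j k
      obtain ⟨_, r₁, p⟩ := q.par_elimOne a c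
      obtain ⟨_, r₂, p'⟩ := r.par_elimOne b d
      exact ⟨_, p, r₁.elimOne_unique r₂ ▸ p'⟩
  | app _ _ i j =>
    cases h₂ with
    | app h k =>
      obtain ⟨_, a, b⟩ := i h
      obtain ⟨_, c, d⟩ := j k
      exact ⟨_, .app a c, .app b d⟩
    | appRoot h k r =>
      obtain ⟨_, a, b⟩ := i h
      obtain ⟨_, c, d⟩ := j k
      obtain ⟨_, r', p⟩ := r.par_app b d
      exact ⟨_, .appRoot a c r', p⟩
  | appRoot _ _ q i j =>
    cases h₂ with
    | app h k =>
      obtain ⟨_, a, b⟩ := i h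
      obtain ⟨_, c, d⟩ := j k
      obtain ⟨_, r', p⟩ := q.par_app a c
      exact ⟨_, p, .appRoot b d r'⟩
    | appRoot h k r =>
      obtain ⟨_, a, b⟩ := i h
      obtain ⟨_, c, d⟩ := j k
      obtain ⟨_, r₁, p⟩ := q.par_app a c
      obtain ⟨_, r₂, p'⟩ := r.par_app b d
      exact ⟨_, p, r₁.app_unique r₂ ▸ p'⟩
  | elimPlus _ _ _ i j l =>
    cases h₂ with
    | elimPlus h k m =>
      obtain ⟨_, a, b⟩ := i h
      obtain ⟨_, c, d⟩ := j k
      obtain ⟨_, e, f⟩ := l m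
      exact ⟨_, .elimPlus a c e, .elimPlus b d f⟩
    | elimPlusRoot h k m r =>
      obtain ⟨_, a, b⟩ := i h
      obtain ⟨_, c, d⟩ := j k
      obtain ⟨_, e, f⟩ := l m
      obtain ⟨_, r', p⟩ := r.par_elimPlus b d f
      exact ⟨_, .elimPlusRoot a c e r', p⟩
  | elimPlusRoot _ _ _ q i j l =>
    cases h₂ with
    | elimPlus h k m =>
      obtain ⟨_, a, b⟩ := i h
      obtain ⟨_, c, d⟩ := j k
      obtain ⟨_, e, f⟩ := l m
      obtain ⟨_, r', p⟩ := q.par_elimPlus a c e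
      exact ⟨_, p, .elimPlusRoot b d f r'⟩
    | elimPlusRoot h k m r =>
      obtain ⟨_, a, b⟩ := i h
      obtain ⟨_, c, d⟩ := j k
      obtain ⟨_, e, f⟩ := l m
      obtain ⟨_, r₁, p⟩ := q.par_elimPlus a c e
      obtain ⟨_, r₂, p'⟩ := r.par_elimPlus b d f
      exact ⟨_, p, r₁.elimPlus_unique r₂ ▸ p'⟩

/-! ### Conversion -/

/-- Two proof-terms are convertible if they have a common reduct, non-deterministic rules being
left out. -/
def Conv : Tm → Tm → Prop := Join (ReflTransGen Par)

theorem Conv.equivalence : Equivalence Conv :=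
  equivalence_join_reflTransGen fun _ _ _ h₁ h₂ =>
    let ⟨d, p, q⟩ := h₁.diamond h₂
    ⟨d, .single p, .single q⟩

theorem Conv.refl (t : Tm) : Conv t t := Conv.equivalence.refl t

theorem Conv.symm {t u : Tm} (h : Conv t u) : Conv u t := Conv.equivalence.symm h

theorem Conv.trans {t u v : Tm} (h : Conv t u) (k : Conv u v) : Conv t v :=
  Conv.equivalence.trans h k

theorem Par.conv {t u : Tm} (h : Par t u) : Conv t u := ⟨u, .single h, .refl⟩

theorem Conv.map {f : Tm → Tm} (hf : ∀ {t t'}, Par t t' → Par (f t) (f t')) {t t' : Tm}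
    (h : Conv t t') : Conv (f t) (f t') :=
  let ⟨r, p, q⟩ := h
  ⟨f r, p.lift f fun _ _ => hf, q.lift f fun _ _ => hf⟩

theorem Conv.plus {t t' u u' : Tm} (h : Conv t t') (k : Conv u u') :
    Conv (plus t u) (plus t' u') :=
  (h.map (f := (Tm.plus · u)) fun p => .plus p (.refl u)).trans
    (k.map (f := Tm.plus t') fun p => .plus (.refl t') p)

theorem Conv.inlr {t t' u u' : Tm} (h : Conv t t') (k : Conv u u') :
    Conv (inlr t u) (inlr t' u') :=
  (h.map (f := (Tm.inlr · u)) fun p => .inlr p (.refl u)).trans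
    (k.map (f := Tm.inlr t') fun p => .inlr (.refl t') p)

theorem Conv.inl {t t' : Tm} (h : Conv t t') : Conv (inl t) (inl t') := h.map .inl

theorem Conv.inr {t t' : Tm} (h : Conv t t') : Conv (inr t) (inr t') := h.map .inr

theorem Conv.scal {t t' : Tm} (a : ℂ) (h : Conv t t') : Conv (scal a t) (scal a t') :=
  h.map (.scal a)

theorem Conv.app {t t' : Tm} (h : Conv t t') (u : Tm) : Conv (app t u) (app t' u) :=
  h.map (f := (Tm.app · u)) fun p => .app p (.refl u)

theorem Conv.elimOne {t t' : Tm} (h : Conv t t') (u : Tm) :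
    Conv (elimOne t u) (elimOne t' u) :=
  h.map (f := (Tm.elimOne · u)) fun p => .elimOne p (.refl u)

theorem Conv.elimPlus {t t' : Tm} (h : Conv t t') (u v : Tm) :
    Conv (elimPlus t u v) (elimPlus t' u v) :=
  h.map (f := (Tm.elimPlus · u v)) fun p => .elimPlus p (.refl u) (.refl v)

theorem RootStep.conv_plus {t u r : Tm} (h : RootStep (plus t u) r) : Conv (plus t u) r :=
  (Par.plusRoot (.refl t) (.refl u) h).conv

theorem RootStep.conv_scal {a : ℂ} {t r : Tm} (h : RootStep (scal a t) r) : Conv (scal a t) r :=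
  (Par.scalRoot (.refl t) h).conv

theorem RootStep.conv_elimPlus {t u v r : Tm} (h : RootStep (elimPlus t u v) r) :
    Conv (elimPlus t u v) r :=
  (Par.elimPlusRoot (.refl t) (.refl u) (.refl v) h).conv

theorem Conv.one (a : ℂ) (t : Tm) : Conv (Tm.elimOne (star a) t) (Tm.scal a t) :=
  (Par.elimOneRoot (.refl _) (.refl t) (.one a t)).conv

theorem Conv.beta (t u : Tm) : Conv (Tm.app (Tm.lam t) u) (t.inst u) :=
  (Par.appRoot (.refl _) (.refl u) (.beta t u)).conv

/-- A property preserved by parallel reduction holds of all reducts. Such invariants show that the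
head of an introduction is never lost. -/
theorem Par.invariant {P : Tm → Prop} (hP : ∀ {t t'}, P t → Par t t' → P t') {t r : Tm}
    (h : ReflTransGen Par t r) (ht : P t) : P r := by
  induction h with
  | refl => exact ht
  | tail _ h i => exact hP i h

theorem Conv.star_inj {a b : ℂ} (h : Conv (star a) (star b)) : a = b := by
  obtain ⟨r, p, q⟩ := h
  have key {c : ℂ} (h : ReflTransGen Par (Tm.star c) r) : r = Tm.star c :=
    Par.invariant (P := (· = Tm.star c)) (by rintro _ _ rfl h; cases h; rfl) h rfl
  have := (key p).symm.trans (key q)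
  injection this

/-- The introductions of a disjunction, written uniformly: the left component is `p` and the right
component is `q`, either of which may be missing. The value when both are missing is not an
introduction; it is a variable so that `mk` stays injective. -/
def Tm.mk : Option Tm → Option Tm → Tm
  | none, none => var 0
  | some t, none => inl t
  | none, some u => inr u
  | some t, some u => inlr t u

theorem Tm.mk_inj {p q p' q' : Option Tm} (h : mk p q = mk p' q') : p = p' ∧ q = q' := by
  cases p <;> cases q <;> cases p' <;> cases q' <;> simp_all [mk]

theorem Par.mk_inv {p q : Option Tm} {r : Tm} (h : Par (mk p q) r) :
    ∃ p' q', r = mk p' q' ∧ Option.Rel Par p p' ∧ Option.Rel Par q q' := by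
  cases p <;> cases q <;> cases h
  · exact ⟨none, none, rfl, .none, .none⟩
  · exact ⟨none, some _, rfl, .none, .some ‹_›⟩
  · exact ⟨some _, none, rfl, .some ‹_›, .none⟩
  · exact ⟨some _, some _, rfl, .some ‹_›, .some ‹_›⟩

theorem optionRel_symm {α : Type*} {R : α → α → Prop} (h : ∀ {x y}, R x y → R y x)
    {p q : Option α} (hpq : Option.Rel R p q) : Option.Rel R q p := by
  cases hpq with
  | none => exact .none
  | some hxy => exact .some (h hxy)

theorem optionRel_comp {α : Type*} {R S T : α → α → Prop}
    (h : ∀ x y z, R x y → S y z → T x z) {p q r : Option α}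
    (hpq : Option.Rel R p q) (hqr : Option.Rel S q r) : Option.Rel T p r := by
  cases hpq with
  | none => cases hqr; exact .none
  | some hxy => cases hqr with | some hyz => exact .some (h _ _ _ hxy hyz)

theorem Conv.mk_inj {p q p' q' : Option Tm} (h : Conv (mk p q) (mk p' q')) :
    Option.Rel Conv p p' ∧ Option.Rel Conv q q' := by
  obtain ⟨r, h, h'⟩ := h
  have key {p q : Option Tm} (h : ReflTransGen Par (mk p q) r) :
      ∃ p' q', r = mk p' q' ∧ Option.Rel Conv p p' ∧ Option.Rel Conv q q' := by
    refine Par.invariant (P := fun r => ∃ p' q', r = mk p' q' ∧ Option.Rel Conv p p' ∧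
      Option.Rel Conv q q') ?_ h ⟨p, q, rfl, ?_, ?_⟩
    · rintro _ _ ⟨p, q, rfl, hp, hq⟩ h
      obtain ⟨p', q', rfl, hp', hq'⟩ := h.mk_inv
      exact ⟨p', q', rfl, optionRel_comp (fun _ _ _ h k => h.trans (Par.conv k)) hp hp',
        optionRel_comp (fun _ _ _ h k => h.trans (Par.conv k)) hq hq'⟩
    · cases p <;> constructor; exact .refl _
    · cases q <;> constructor; exact .refl _
  obtain ⟨p₁, q₁, rfl, hp, hq⟩ := key h
  obtain ⟨p₂, q₂, e, hp', hq'⟩ := key h'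
  obtain ⟨rfl, rfl⟩ := Tm.mk_inj e
  exact ⟨optionRel_comp (R := Conv) (S := Conv) (fun _ _ _ => .trans) hp (optionRel_symm .symm hp'),
    optionRel_comp (R := Conv) (S := Conv) (fun _ _ _ => .trans) hq (optionRel_symm .symm hq')⟩

/-! ### Semimodule laws up to a partial equivalence relation -/

/-- The laws of a commutative semigroup with a linear action of `ℂ`, up to a partial equivalence
relation `R` and on the elements related to themselves. There is no neutral element, and `0` need
not act as zero: `scal 0 (inl t)` reduces to an `inl`, which differs from an `inr`. -/
structure LinLaws {X : Type*} (R : X → X → Prop) (add : X → X → X) (smul : ℂ → X → X) : Prop where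
  symm {x y : X} : R x y → R y x
  trans {x y z : X} : R x y → R y z → R x z
  add_congr {x x' y y' : X} : R x x' → R y y' → R (add x y) (add x' y')
  smul_congr (a : ℂ) {x x' : X} : R x x' → R (smul a x) (smul a x')
  add_comm {x y : X} : R x x → R y y → R (add x y) (add y x)
  add_assoc {x y z : X} : R x x → R y y → R z z → R (add (add x y) z) (add x (add y z))
  smul_add (a : ℂ) {x y : X} : R x x → R y y → R (smul a (add x y)) (add (smul a x) (smul a y))
  add_smul (a b : ℂ) {x : X} : R x x → R (smul (a + b) x) (add (smul a x) (smul b x))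
  mul_smul (a b : ℂ) {x : X} : R x x → R (smul (a * b) x) (smul a (smul b x))

/-- The operations that linear maps have to preserve: the sum, and the multiplication by a scalar.
Both are treated as binary operations, the latter ignoring its second argument, so that each
statement about linearity is proved once for both. -/
inductive LOp : Type
  | add : LOp
  | smul (a : ℂ) : LOp

/-- The binary operation denoted by an `LOp`. -/
def LOp.eval {X : Type*} (add : X → X → X) (smul : ℂ → X → X) : LOp → X → X → X
  | .add, x, y => add x y
  | .smul a, x, _ => smul a x

namespace LinLaws

variable {X : Type*} {R : X → X → Prop} {add : X → X → X} {smul : ℂ → X → X}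

theorem left (L : LinLaws R add smul) {x y : X} (h : R x y) : R x x := L.trans h (L.symm h)

theorem right (L : LinLaws R add smul) {x y : X} (h : R x y) : R y y := L.trans (L.symm h) h

theorem op_congr (L : LinLaws R add smul) (o : LOp) {x x' y y' : X} (hx : R x x') (hy : R y y') :
    R (o.eval add smul x y) (o.eval add smul x' y') := by
  cases o with
  | add => exact L.add_congr hx hy
  | smul a => exact L.smul_congr a hx

theorem add_add_add_comm (L : LinLaws R add smul) {x y z w : X} (hx : R x x) (hy : R y y)
    (hz : R z z) (hw : R w w) : R (add (add x y) (add z w)) (add (add x z) (add y w)) := by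
  have h₁ := L.add_assoc hx hy (L.add_congr hz hw)
  have h₂ := L.add_congr hx (L.symm (L.add_assoc hy hz hw))
  have h₃ := L.add_congr hx (L.add_congr (L.add_comm hy hz) hw)
  have h₄ := L.add_congr hx (L.add_assoc hz hy hw)
  have h₅ := L.symm (L.add_assoc hx hz (L.add_congr hy hw))
  exact L.trans h₁ (L.trans h₂ (L.trans h₃ (L.trans h₄ h₅)))

theorem smul_comm (L : LinLaws R add smul) (a b : ℂ) {x : X} (hx : R x x) :
    R (smul a (smul b x)) (smul b (smul a x)) :=
  L.trans (L.symm (L.mul_smul a b hx)) (mul_comm a b ▸ L.mul_smul b a hx)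

/-- Any two of the operations commute with each other. This is what makes sums and multiples of
linear maps linear. -/
theorem op_comm (L : LinLaws R add smul) (o o' : LOp) {x y z w : X} (hx : R x x) (hy : R y y)
    (hz : R z z) (hw : R w w) :
    R (o.eval add smul (o'.eval add smul x y) (o'.eval add smul z w))
      (o'.eval add smul (o.eval add smul x z) (o.eval add smul y w)) := by
  cases o with
  | add =>
    cases o' with
    | add => exact L.add_add_add_comm hx hy hz hw
    | smul a => exact L.symm (L.smul_add a hx hz)
  | smul a =>
    cases o' with
    | add => exact L.smul_add a hx hy
    | smul b => exact L.smul_comm a b hx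

end LinLaws

/-- Addition with an extra element `none` as neutral element. -/
def optAdd {X : Type*} (add : X → X → X) : Option X → Option X → Option X
  | none, q => q
  | some x, none => some x
  | some x, some y => some (add x y)

/-- Scalar multiplication fixing the extra element `none`. -/
def optSmul {X : Type*} (smul : ℂ → X → X) (a : ℂ) : Option X → Option X := Option.map (smul a)

/-- Adjoining a neutral element, by which the missing components of `inl` and `inr` are
represented, preserves the laws. -/
theorem LinLaws.option {X : Type*} {R : X → X → Prop} {add : X → X → X} {smul : ℂ → X → X}
    (L : LinLaws R add smul) :
    LinLaws (Option.Rel R) (optAdd add) (optSmul smul) where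
  symm := optionRel_symm L.symm
  trans := optionRel_comp (R := R) (S := R) fun _ _ _ => L.trans
  add_congr h k := by
    cases h with
    | none => exact k
    | some h =>
      cases k with
      | none => exact .some h
      | some k => exact .some (L.add_congr h k)
  smul_congr a _ _ h := by
    cases h with
    | none => exact .none
    | some h => exact .some (L.smul_congr a h)
  add_comm h k := by
    cases h with
    | none => cases k with
      | none => exact .none
      | some k => exact .some k
    | some h => cases k with
      | none => exact .some h
      | some k => exact .some (L.add_comm h k)
  add_assoc h k l := by
    cases h with
    | none => cases k with
      | none => exact l
      | some k => cases l with
        | none => exact .some k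
        | some l => exact .some (L.add_congr k l)
    | some h => cases k with
      | none => cases l with
        | none => exact .some h
        | some l => exact .some (L.add_congr h l)
      | some k => cases l with
        | none => exact .some (L.add_congr h k)
        | some l => exact .some (L.add_assoc h k l)
  smul_add a _ _ h k := by
    cases h with
    | none => cases k with
      | none => exact .none
      | some k => exact .some (L.smul_congr a k)
    | some h => cases k with
      | none => exact .some (L.smul_congr a h)
      | some k => exact .some (L.smul_add a h k)
  add_smul a b _ h := by
    cases h with
    | none => exact .none
    | some h => exact .some (L.add_smul a b h)
  mul_smul a b _ h := by
    cases h with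
    | none => exact .none
    | some h => exact .some (L.mul_smul a b h)

/-! ### Extensional equality of proof-terms -/

/-- The operations of the calculus: the sum, or the product by a scalar. -/
abbrev lop (o : LOp) : Tm → Tm → Tm := o.eval plus scal

/-- The operations on possibly missing components. -/
abbrev olop (o : LOp) : Option Tm → Option Tm → Option Tm :=
  o.eval (optAdd plus) (optSmul scal)

theorem Conv.op (o : LOp) {t t' u u' : Tm} (h : Conv t t') (k : Conv u u') :
    Conv (lop o t u) (lop o t' u') := by
  cases o with
  | add => exact h.plus k
  | smul a => exact h.scal a

/-- A proof-term of an implication that has an abstraction as a value and preserves the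
operations. -/
def LinFun (R S : Tm → Tm → Prop) (t : Tm) : Prop :=
  (∃ b, Conv t (lam b)) ∧
    ∀ (o : LOp) (u v : Tm), R u u → R v v → S (app t (lop o u v)) (lop o (app t u) (app t v))

/-- Extensional equality of linear functions. -/
def FunRel (R S : Tm → Tm → Prop) (t t' : Tm) : Prop :=
  LinFun R S t ∧ LinFun R S t' ∧ ∀ u u', R u u' → S (app t u) (app t' u')

/-- Componentwise equality of introductions of a disjunction. -/
def SumRel (R S : Tm → Tm → Prop) (t t' : Tm) : Prop :=
  ∃ p q p' q', (p ≠ none ∨ q ≠ none) ∧ Conv t (mk p q) ∧ Conv t' (mk p' q') ∧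
    Option.Rel R p p' ∧ Option.Rel S q q'

/-- The logical relation: extensional equality of proof-terms of a proposition. It is a partial
equivalence relation, and being related to oneself implies having a value that, in the case of an
implication, is a linear function. -/
def LogEq : Prp → Tm → Tm → Prop
  | .one => fun t t' => ∃ a, Conv t (star a) ∧ Conv t' (star a)
  | .limp A B => FunRel (LogEq A) (LogEq B)
  | .oplus A B => SumRel (LogEq A) (LogEq B)

/-- A partial equivalence relation on proof-terms that is invariant under conversion and satisfies
the semimodule laws. -/
structure LinPER (R : Tm → Tm → Prop) : Prop extends LinLaws R plus scal where
  conv {t t' u u' : Tm} : Conv t t' → Conv u u' → R t' u' → R t u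

theorem LinPER.one : LinPER (LogEq .one) where
  symm := fun ⟨a, h, k⟩ => ⟨a, k, h⟩
  trans := by
    rintro _ _ _ ⟨a, h, k⟩ ⟨b, h', k'⟩
    obtain rfl := (k.symm.trans h').star_inj
    exact ⟨a, h, k'⟩
  add_congr := by
    rintro _ _ _ _ ⟨a, h, k⟩ ⟨b, h', k'⟩
    exact ⟨a + b, (h.plus h').trans (RootStep.plusStar a b).conv_plus,
      (k.plus k').trans (RootStep.plusStar a b).conv_plus⟩
  smul_congr := by
    rintro c _ _ ⟨a, h, k⟩
    exact ⟨c * a, (h.scal c).trans (RootStep.scalStar c a).conv_scal,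
      (k.scal c).trans (RootStep.scalStar c a).conv_scal⟩
  add_comm := by
    rintro _ _ ⟨a, h, -⟩ ⟨b, k, -⟩
    exact ⟨a + b, (h.plus k).trans (RootStep.plusStar a b).conv_plus,
      add_comm b a ▸ (k.plus h).trans (RootStep.plusStar b a).conv_plus⟩
  add_assoc := by
    rintro _ _ _ ⟨a, h, -⟩ ⟨b, k, -⟩ ⟨c, l, -⟩
    refine ⟨a + b + c, ?_, ?_⟩
    · exact (((h.plus k).trans (RootStep.plusStar a b).conv_plus).plus l).trans
        (RootStep.plusStar _ c).conv_plus
    · rw [_root_.add_assoc]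
      exact (h.plus ((k.plus l).trans (RootStep.plusStar b c).conv_plus)).trans
        (RootStep.plusStar a _).conv_plus
  smul_add := by
    rintro c _ _ ⟨a, h, -⟩ ⟨b, k, -⟩
    refine ⟨c * (a + b), ?_, ?_⟩
    · exact (((h.plus k).trans (RootStep.plusStar a b).conv_plus).scal c).trans
        (RootStep.scalStar c _).conv_scal
    · rw [mul_add]
      exact (((h.scal c).trans (RootStep.scalStar c a).conv_scal).plus
        ((k.scal c).trans (RootStep.scalStar c b).conv_scal)).trans
        (RootStep.plusStar _ _).conv_plus
  add_smul := by
    rintro c d _ ⟨a, h, -⟩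
    refine ⟨(c + d) * a, (h.scal _).trans (RootStep.scalStar _ a).conv_scal, ?_⟩
    rw [add_mul]
    exact (((h.scal c).trans (RootStep.scalStar c a).conv_scal).plus
      ((h.scal d).trans (RootStep.scalStar d a).conv_scal)).trans
      (RootStep.plusStar _ _).conv_plus
  mul_smul := by
    rintro c d _ ⟨a, h, -⟩
    refine ⟨c * d * a, (h.scal _).trans (RootStep.scalStar _ a).conv_scal, ?_⟩
    rw [mul_assoc]
    exact (((h.scal d).trans (RootStep.scalStar d a).conv_scal).scal c).trans
      (RootStep.scalStar c _).conv_scal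
  conv := by
    rintro _ _ _ _ h k ⟨a, h', k'⟩
    exact ⟨a, h.trans h', k.trans k'⟩

section Function

variable {R S : Tm → Tm → Prop}

theorem Conv.op_lam (o : LOp) {t u b c : Tm} (h : Conv t (lam b)) (k : Conv u (lam c)) :
    Conv (lop o t u) (lam (lop o b c)) := by
  cases o with
  | add => exact (h.plus k).trans (RootStep.plusLam b c).conv_plus
  | smul a => exact (h.scal a).trans (RootStep.scalLam a b).conv_scal

theorem op_inst (o : LOp) (b c u : Tm) : (lop o b c).inst u = lop o (b.inst u) (c.inst u) := by
  cases o <;> rfl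

/-- The operations act pointwise on functions. -/
theorem LinFun.app_op (o : LOp) {t u : Tm} (ht : LinFun R S t) (hu : LinFun R S u) (v : Tm) :
    Conv (app (lop o t u) v) (lop o (app t v) (app u v)) := by
  obtain ⟨⟨b, hb⟩, -⟩ := ht
  obtain ⟨⟨c, hc⟩, -⟩ := hu
  refine ((hb.op_lam o hc).app v).trans ((Conv.beta _ v).trans ?_)
  rw [op_inst]
  exact Conv.op o ((hb.app v).trans (.beta b v)).symm ((hc.app v).trans (.beta c v)).symm

/-- Sums and multiples of linear functions are linear. -/
theorem LinFun.op (hS : LinPER S) (o : LOp) {x y : Tm} (hx : FunRel R S x x)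
    (hy : FunRel R S y y) : LinFun R S (lop o x y) := by
  obtain ⟨b, hb⟩ := hx.1.1
  obtain ⟨c, hc⟩ := hy.1.1
  refine ⟨⟨_, hb.op_lam o hc⟩, fun o' u v hu hv => ?_⟩
  refine hS.conv (hx.1.app_op o hy.1 _)
    (Conv.op o' (hx.1.app_op o hy.1 u) (hx.1.app_op o hy.1 v)) ?_
  exact hS.trans (hS.op_congr o (hx.1.2 o' u v hu hv) (hy.1.2 o' u v hu hv))
    (hS.op_comm o o' (hx.2.2 _ _ hu) (hx.2.2 _ _ hv) (hy.2.2 _ _ hu) (hy.2.2 _ _ hv))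

theorem FunRel.of_pointwise (hR : LinPER R) (hS : LinPER S) {t t' : Tm} (ht : LinFun R S t)
    (ht' : FunRel R S t' t') (h : ∀ u, R u u → S (app t u) (app t' u)) : FunRel R S t t' :=
  ⟨ht, ht'.1, fun u u' hu => hS.trans (h u (hR.left hu)) (ht'.2.2 u u' hu)⟩

theorem FunRel.symm (hR : LinPER R) (hS : LinPER S) {t t' : Tm} (h : FunRel R S t t') :
    FunRel R S t' t :=
  ⟨h.2.1, h.1, fun u u' hu => hS.symm (h.2.2 u' u (hR.symm hu))⟩

theorem FunRel.trans (hR : LinPER R) (hS : LinPER S) {t t' t'' : Tm} (h : FunRel R S t t')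
    (k : FunRel R S t' t'') : FunRel R S t t'' :=
  ⟨h.1, k.2.1, fun u u' hu => hS.trans (h.2.2 u u' hu) (k.2.2 u' u' (hR.right hu))⟩

theorem FunRel.op_congr (hR : LinPER R) (hS : LinPER S) (o : LOp) {x x' y y' : Tm}
    (hx : FunRel R S x x') (hy : FunRel R S y y') : FunRel R S (lop o x y) (lop o x' y') :=
  ⟨.op hS o (hx.trans hR hS (hx.symm hR hS)) (hy.trans hR hS (hy.symm hR hS)),
    .op hS o ((hx.symm hR hS).trans hR hS hx) ((hy.symm hR hS).trans hR hS hy),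
    fun u u' hu => hS.conv (hx.1.app_op o hy.1 u) (hx.2.1.app_op o hy.2.1 u')
      (hS.op_congr o (hx.2.2 u u' hu) (hy.2.2 u u' hu))⟩

theorem LinPER.limp (hR : LinPER R) (hS : LinPER S) : LinPER (FunRel R S) := by
  have congr (o : LOp) {x x' y y' : Tm} (hx : FunRel R S x x') (hy : FunRel R S y y') :
    FunRel R S (lop o x y) (lop o x' y') := hx.op_congr hR hS o hy
  have add {x y : Tm} (hx : FunRel R S x x) (hy : FunRel R S y y) :
    FunRel R S (plus x y) (plus x y) := congr .add hx hy
  have smul (a : ℂ) {x : Tm} (hx : FunRel R S x x) : FunRel R S (scal a x) (scal a x) :=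
    congr (.smul a) hx hx
  have app_add {x y : Tm} (hx : FunRel R S x x) (hy : FunRel R S y y) (u : Tm) :
    Conv (app (plus x y) u) (plus (app x u) (app y u)) := hx.1.app_op .add hy.1 u
  have app_smul (a : ℂ) {x : Tm} (hx : FunRel R S x x) (u : Tm) :
    Conv (app (scal a x) u) (scal a (app x u)) := hx.1.app_op (.smul a) hx.1 u
  constructor
  · constructor
    · exact fun h => h.symm hR hS
    · exact fun h k => h.trans hR hS k
    · exact congr .add
    · exact fun a _ _ hx => congr (.smul a) hx hx
    · intro x y hx hy
      refine .of_pointwise hR hS (add hx hy).1 (add hy hx) fun u hu => ?_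
      exact hS.conv (app_add hx hy u) (app_add hy hx u)
        (hS.add_comm (hx.2.2 u u hu) (hy.2.2 u u hu))
    · intro x y z hx hy hz
      refine .of_pointwise hR hS (add (add hx hy) hz).1 (add hx (add hy hz)) fun u hu => ?_
      exact hS.conv ((app_add (add hx hy) hz u).trans ((app_add hx hy u).plus (.refl _)))
        ((app_add hx (add hy hz) u).trans ((Conv.refl _).plus (app_add hy hz u)))
        (hS.add_assoc (hx.2.2 u u hu) (hy.2.2 u u hu) (hz.2.2 u u hu))
    · intro a x y hx hy
      refine .of_pointwise hR hS (smul a (add hx hy)).1 (add (smul a hx) (smul a hy))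
        fun u hu => ?_
      exact hS.conv ((app_smul a (add hx hy) u).trans ((app_add hx hy u).scal a))
        ((app_add (smul a hx) (smul a hy) u).trans ((app_smul a hx u).plus (app_smul a hy u)))
        (hS.smul_add a (hx.2.2 u u hu) (hy.2.2 u u hu))
    · intro a b x hx
      refine .of_pointwise hR hS (smul (a + b) hx).1 (add (smul a hx) (smul b hx))
        fun u hu => ?_
      exact hS.conv (app_smul (a + b) hx u)
        ((app_add (smul a hx) (smul b hx) u).trans ((app_smul a hx u).plus (app_smul b hx u)))
        (hS.add_smul a b (hx.2.2 u u hu))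
    · intro a b x hx
      refine .of_pointwise hR hS (smul (a * b) hx).1 (smul a (smul b hx)) fun u hu => ?_
      exact hS.conv (app_smul (a * b) hx u)
        ((app_smul a (smul b hx) u).trans ((app_smul b hx u).scal a))
        (hS.mul_smul a b (hx.2.2 u u hu))
  · have lin {t t' : Tm} (h : Conv t t') (ht : LinFun R S t') : LinFun R S t :=
      ⟨ht.1.imp fun _ hb => h.trans hb, fun o u v hu hv =>
        hS.conv (h.app _) (Conv.op o (h.app u) (h.app v)) (ht.2 o u v hu hv)⟩
    exact @fun _ _ _ _ h k hr => ⟨lin h hr.1, lin k hr.2.1, fun u u' hu =>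
      hS.conv (h.app u) (k.app u') (hr.2.2 u u' hu)⟩

end Function

section Sum

variable {R S : Tm → Tm → Prop}

theorem conv_op_mk (o : LOp) {p q p' q' : Option Tm} (h : p ≠ none ∨ q ≠ none)
    (h' : p' ≠ none ∨ q' ≠ none) :
    (olop o p p' ≠ none ∨ olop o q q' ≠ none) ∧
      Conv (lop o (mk p q) (mk p' q')) (mk (olop o p p') (olop o q q')) := by
  cases o with
  | add =>
    cases p <;> cases q <;> cases p' <;> cases q' <;>
      first
      | simp at h; done
      | simp at h'; done
      | exact ⟨by simp [LOp.eval, optAdd], RootStep.conv_plus (by constructor)⟩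
  | smul a =>
    cases p <;> cases q <;>
      first
      | simp at h; done
      | exact ⟨by simp [LOp.eval, optSmul], RootStep.conv_scal (by constructor)⟩

theorem SumRel.symm (hR : LinPER R) (hS : LinPER S) {t t' : Tm} (h : SumRel R S t t') :
    SumRel R S t' t := by
  obtain ⟨p, q, p', q', hn, h, h', hp, hq⟩ := h
  refine ⟨p', q', p, q, ?_, h', h, optionRel_symm hR.symm hp, optionRel_symm hS.symm hq⟩
  cases hp <;> cases hq <;> simp_all

theorem SumRel.trans (hR : LinPER R) (hS : LinPER S) {t t' t'' : Tm} (h : SumRel R S t t')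
    (k : SumRel R S t' t'') : SumRel R S t t'' := by
  obtain ⟨p, q, p₁, q₁, hn, h, h', hp, hq⟩ := h
  obtain ⟨p₂, q₂, p', q', -, k, k', hp', hq'⟩ := k
  obtain ⟨ep, eq⟩ := (h'.symm.trans k).mk_inj
  refine ⟨p, q, p', q', hn, h, k', ?_, ?_⟩
  · exact optionRel_comp (R := R) (S := R) (fun _ _ _ => hR.trans) hp
      (optionRel_comp (R := Conv) (S := R) (fun _ _ _ h k => hR.conv h (.refl _) k) ep hp')
  · exact optionRel_comp (R := S) (S := S) (fun _ _ _ => hS.trans) hq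
      (optionRel_comp (R := Conv) (S := S) (fun _ _ _ h k => hS.conv h (.refl _) k) eq hq')

theorem SumRel.self (hR : LinPER R) (hS : LinPER S) {t : Tm} (h : SumRel R S t t) :
    ∃ p q, (p ≠ none ∨ q ≠ none) ∧ Conv t (mk p q) ∧ Option.Rel R p p ∧ Option.Rel S q q := by
  obtain ⟨p, q, _, _, hn, h, -, hp, hq⟩ := h
  exact ⟨p, q, hn, h, hR.option.left hp, hS.option.left hq⟩

theorem SumRel.op_congr (hR : LinPER R) (hS : LinPER S) (o : LOp) {x x' y y' : Tm}
    (hx : SumRel R S x x') (hy : SumRel R S y y') : SumRel R S (lop o x y) (lop o x' y') := by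
  obtain ⟨p, q, p', q', hn, h, h', hp, hq⟩ := hx
  obtain ⟨r, s, r', s', kn, k, k', hr, hs⟩ := hy
  have hn' : p' ≠ none ∨ q' ≠ none := by cases hp <;> cases hq <;> simp_all
  have kn' : r' ≠ none ∨ s' ≠ none := by cases hr <;> cases hs <;> simp_all
  obtain ⟨d, c⟩ := conv_op_mk o hn kn
  exact ⟨_, _, _, _, d, (h.op o k).trans c, (h'.op o k').trans (conv_op_mk o hn' kn').2,
    hR.option.op_congr o hp hr, hS.option.op_congr o hq hs⟩

/-- The operations act componentwise on introductions of a disjunction. -/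
theorem Conv.op_mk (o : LOp) {t u : Tm} {p q p' q' : Option Tm} (h : p ≠ none ∨ q ≠ none)
    (h' : p' ≠ none ∨ q' ≠ none) (ht : Conv t (mk p q)) (hu : Conv u (mk p' q')) :
    Conv (lop o t u) (mk (olop o p p') (olop o q q')) :=
  (ht.op o hu).trans (conv_op_mk o h h').2

theorem LinPER.oplus (hR : LinPER R) (hS : LinPER S) : LinPER (SumRel R S) := by
  constructor
  · constructor
    · exact fun h => h.symm hR hS
    · exact fun h k => h.trans hR hS k
    · exact fun hx hy => hx.op_congr hR hS .add hy
    · exact fun a _ _ hx => hx.op_congr hR hS (.smul a) hx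
    · intro x y hx hy
      obtain ⟨p, q, hn, h, hp, hq⟩ := hx.self hR hS
      obtain ⟨r, s, kn, k, hr, hs⟩ := hy.self hR hS
      exact ⟨_, _, _, _, (conv_op_mk .add hn kn).1, h.op_mk .add hn kn k, k.op_mk .add kn hn h,
        hR.option.add_comm hp hr, hS.option.add_comm hq hs⟩
    · intro x y z hx hy hz
      obtain ⟨p, q, hn, h, hp, hq⟩ := hx.self hR hS
      obtain ⟨r, s, kn, k, hr, hs⟩ := hy.self hR hS
      obtain ⟨v, w, ln, l, hv, hw⟩ := hz.self hR hS
      have hk := (conv_op_mk .add hn kn).1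
      exact ⟨_, _, _, _, (conv_op_mk .add hk ln).1, (h.op_mk .add hn kn k).op_mk .add hk ln l,
        h.op_mk .add hn (conv_op_mk .add kn ln).1 (k.op_mk .add kn ln l),
        hR.option.add_assoc hp hr hv, hS.option.add_assoc hq hs hw⟩
    · intro a x y hx hy
      obtain ⟨p, q, hn, h, hp, hq⟩ := hx.self hR hS
      obtain ⟨r, s, kn, k, hr, hs⟩ := hy.self hR hS
      have hk := (conv_op_mk .add hn kn).1
      exact ⟨_, _, _, _, (conv_op_mk (.smul a) hk hk).1,
        (h.op_mk .add hn kn k).op_mk (.smul a) hk hk (h.op_mk .add hn kn k),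
        (h.op_mk (.smul a) hn hn h).op_mk .add (conv_op_mk (.smul a) hn hn).1
          (conv_op_mk (.smul a) kn kn).1 (k.op_mk (.smul a) kn kn k),
        hR.option.smul_add a hp hr, hS.option.smul_add a hq hs⟩
    · intro a b x hx
      obtain ⟨p, q, hn, h, hp, hq⟩ := hx.self hR hS
      exact ⟨_, _, _, _, (conv_op_mk (.smul (a + b)) hn hn).1, h.op_mk (.smul (a + b)) hn hn h,
        (h.op_mk (.smul a) hn hn h).op_mk .add (conv_op_mk (.smul a) hn hn).1
          (conv_op_mk (.smul b) hn hn).1 (h.op_mk (.smul b) hn hn h),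
        hR.option.add_smul a b hp, hS.option.add_smul a b hq⟩
    · intro a b x hx
      obtain ⟨p, q, hn, h, hp, hq⟩ := hx.self hR hS
      have hb := (conv_op_mk (.smul b) hn hn).1
      exact ⟨_, _, _, _, (conv_op_mk (.smul (a * b)) hn hn).1, h.op_mk (.smul (a * b)) hn hn h,
        (h.op_mk (.smul b) hn hn h).op_mk (.smul a) hb hb (h.op_mk (.smul b) hn hn h),
        hR.option.mul_smul a b hp, hS.option.mul_smul a b hq⟩
  · rintro _ _ _ _ h k ⟨p, q, p', q', hn, h', k', hp, hq⟩
    exact ⟨p, q, p', q', hn, h.trans h', k.trans k', hp, hq⟩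

end Sum

theorem LogEq.linPER (A : Prp) : LinPER (LogEq A) := by
  induction A with
  | one => exact .one
  | limp A B hA hB => exact hA.limp hB
  | oplus A B hA hB => exact hA.oplus hB

/-! ### Eliminations and extensional equality -/

section Elim

variable {R S T : Tm → Tm → Prop}

theorem elimOne_congr (hT : LinPER T) {t t' u u' : Tm} (ht : LogEq .one t t') (hu : T u u') :
    T (elimOne t u) (elimOne t' u') := by
  obtain ⟨a, h, h'⟩ := ht
  exact hT.conv ((h.elimOne u).trans (.one a u)) ((h'.elimOne u').trans (.one a u'))
    (hT.smul_congr a hu)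

/-- Linearity in the scalar eliminated, which is where `(a + b) • u = a • u + b • u` and
`(c * a) • u = c • (a • u)` are needed. -/
theorem elimOne_op_left (hT : LinPER T) (o : LOp) {t₁ t₂ u : Tm} (h₁ : LogEq .one t₁ t₁)
    (h₂ : LogEq .one t₂ t₂) (hu : T u u) :
    T (elimOne (lop o t₁ t₂) u) (lop o (elimOne t₁ u) (elimOne t₂ u)) := by
  obtain ⟨a, h, -⟩ := h₁
  obtain ⟨b, k, -⟩ := h₂
  refine hT.conv ?_ (((h.elimOne u).trans (.one a u)).op o ((k.elimOne u).trans (.one b u)))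
    (t' := scal (match o with | .add => a + b | .smul c => c * a) u) ?_
  · refine ((h.op o k).elimOne u).trans ?_
    cases o with
    | add => exact ((RootStep.plusStar a b).conv_plus.elimOne u).trans (.one _ u)
    | smul c => exact ((RootStep.scalStar c a).conv_scal.elimOne u).trans (.one _ u)
  · cases o with
    | add => exact hT.add_smul a b hu
    | smul c => exact hT.mul_smul c a hu

theorem elimOne_op_right (hT : LinPER T) (o : LOp) {t u₁ u₂ : Tm} (ht : LogEq .one t t)
    (h₁ : T u₁ u₁) (h₂ : T u₂ u₂) :
    T (elimOne t (lop o u₁ u₂)) (lop o (elimOne t u₁) (elimOne t u₂)) := by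
  obtain ⟨a, h, -⟩ := ht
  exact hT.conv ((h.elimOne _).trans (.one a _))
    (((h.elimOne _).trans (.one a _)).op o ((h.elimOne _).trans (.one a _)))
    (hT.op_comm (.smul a) o h₁ h₂ h₁ h₂)

/-- The elimination of a disjunction sums the contributions of the components that are present. -/
theorem conv_elimPlus_mk {t : Tm} {p q : Option Tm} (hn : p ≠ none ∨ q ≠ none)
    (h : Conv t (mk p q)) (u v : Tm) :
    ∃ r, optAdd plus (p.map u.inst) (q.map v.inst) = some r ∧ Conv (elimPlus t u v) r := by
  cases p <;> cases q
  · simp at hn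
  · exact ⟨_, rfl, (h.elimPlus u v).trans (RootStep.caseInr _ _ _).conv_elimPlus⟩
  · exact ⟨_, rfl, (h.elimPlus u v).trans (RootStep.caseInl _ _ _).conv_elimPlus⟩
  · exact ⟨_, rfl, (h.elimPlus u v).trans (RootStep.caseInlr _ _ _ _).conv_elimPlus⟩

theorem optionRel_map {f g : Tm → Tm} (h : ∀ x x', R x x' → T (f x) (g x')) {p p' : Option Tm}
    (hp : Option.Rel R p p') : Option.Rel T (p.map f) (p'.map g) := by
  cases hp with
  | none => exact .none
  | some hx => exact .some (h _ _ hx)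

theorem elimPlus_congr (hT : LinPER T) {t t' u u' v v' : Tm}
    (ht : SumRel R S t t') (hu : ∀ x x', R x x' → T (u.inst x) (u'.inst x'))
    (hv : ∀ x x', S x x' → T (v.inst x) (v'.inst x')) :
    T (elimPlus t u v) (elimPlus t' u' v') := by
  obtain ⟨p, q, p', q', hn, h, h', hp, hq⟩ := ht
  have hn' : p' ≠ none ∨ q' ≠ none := by cases hp <;> cases hq <;> simp_all
  obtain ⟨r, e, c⟩ := conv_elimPlus_mk hn h u v
  obtain ⟨r', e', c'⟩ := conv_elimPlus_mk hn' h' u' v'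
  have key := hT.option.add_congr (optionRel_map hu hp) (optionRel_map hv hq)
  rw [e, e'] at key
  cases key with | some key => exact hT.conv c c' key

theorem olop_some (o : LOp) (x y : Tm) : olop o (some x) (some y) = some (lop o x y) := by
  cases o <;> rfl

/-- Elimination is linear in the scrutinee. The contributions of the two branches are summed, so this
also needs that the sum commutes with the operation. -/
theorem elimPlus_op_left (hR : LinPER R) (hS : LinPER S) (hT : LinPER T) (o : LOp)
    {t₁ t₂ u v : Tm} (h₁ : SumRel R S t₁ t₁) (h₂ : SumRel R S t₂ t₂)
    (hu : ∀ x x', R x x' → T (u.inst x) (u.inst x'))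
    (hv : ∀ x x', S x x' → T (v.inst x) (v.inst x'))
    (lu : ∀ x y, R x x → R y y → T (u.inst (lop o x y)) (lop o (u.inst x) (u.inst y)))
    (lv : ∀ x y, S x x → S y y → T (v.inst (lop o x y)) (lop o (v.inst x) (v.inst y))) :
    T (elimPlus (lop o t₁ t₂) u v) (lop o (elimPlus t₁ u v) (elimPlus t₂ u v)) := by
  obtain ⟨p, q, hn, h, hp, hq⟩ := h₁.self hR hS
  obtain ⟨p', q', kn, k, hp', hq'⟩ := h₂.self hR hS
  have map {R : Tm → Tm → Prop} {u : Tm} {p p' : Option Tm} (hp : Option.Rel R p p)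
      (hp' : Option.Rel R p' p') (hu : ∀ x x', R x x' → T (u.inst x) (u.inst x'))
      (lu : ∀ x y, R x x → R y y → T (u.inst (lop o x y)) (lop o (u.inst x) (u.inst y))) :
      Option.Rel T ((olop o p p').map u.inst) (olop o (p.map u.inst) (p'.map u.inst)) := by
    cases o with
    | add =>
      cases hp with
      | none => exact optionRel_map hu hp'
      | some h => cases hp' with
        | none => exact .some (hu _ _ h)
        | some k => exact .some (lu _ _ h k)
    | smul a =>
      cases hp with
      | none => exact .none
      | some h => exact .some (lu _ _ h h)
  obtain ⟨r, e, c⟩ := conv_elimPlus_mk (conv_op_mk o hn kn).1 (h.op_mk o hn kn k) u v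
  obtain ⟨r₁, e₁, c₁⟩ := conv_elimPlus_mk hn h u v
  obtain ⟨r₂, e₂, c₂⟩ := conv_elimPlus_mk kn k u v
  have key := hT.option.trans (hT.option.add_congr (map hp hp' hu lu) (map hq hq' hv lv))
    (hT.option.op_comm .add o (optionRel_map hu hp) (optionRel_map hu hp')
      (optionRel_map hv hq) (optionRel_map hv hq'))
  change Option.Rel T (optAdd plus _ _) (olop o (optAdd plus _ _) (optAdd plus _ _)) at key
  rw [e, e₁, e₂, olop_some] at key
  cases key with | some key => exact hT.conv c (c₁.op o c₂) key

/-- Elimination is linear in its pair of branches. -/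
theorem elimPlus_op_right (hR : LinPER R) (hS : LinPER S) (hT : LinPER T) (o : LOp)
    {t u u₁ u₂ v v₁ v₂ : Tm} (ht : SumRel R S t t)
    (hu : ∀ x, R x x → T (u.inst x) (lop o (u₁.inst x) (u₂.inst x)))
    (hv : ∀ x, S x x → T (v.inst x) (lop o (v₁.inst x) (v₂.inst x)))
    (hu₁ : ∀ x x', R x x' → T (u₁.inst x) (u₁.inst x'))
    (hu₂ : ∀ x x', R x x' → T (u₂.inst x) (u₂.inst x'))
    (hv₁ : ∀ x x', S x x' → T (v₁.inst x) (v₁.inst x'))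
    (hv₂ : ∀ x x', S x x' → T (v₂.inst x) (v₂.inst x')) :
    T (elimPlus t u v) (lop o (elimPlus t u₁ v₁) (elimPlus t u₂ v₂)) := by
  obtain ⟨p, q, hn, h, hp, hq⟩ := ht.self hR hS
  have map {R : Tm → Tm → Prop} {u u₁ u₂ : Tm} {p : Option Tm} (hp : Option.Rel R p p)
      (hu : ∀ x, R x x → T (u.inst x) (lop o (u₁.inst x) (u₂.inst x))) :
      Option.Rel T (p.map u.inst) (olop o (p.map u₁.inst) (p.map u₂.inst)) := by
    cases hp with
    | none => cases o <;> exact .none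
    | some h => exact (olop_some o _ _) ▸ .some (hu _ h)
  obtain ⟨r, e, c⟩ := conv_elimPlus_mk hn h u v
  obtain ⟨r₁, e₁, c₁⟩ := conv_elimPlus_mk hn h u₁ v₁
  obtain ⟨r₂, e₂, c₂⟩ := conv_elimPlus_mk hn h u₂ v₂
  have key := hT.option.trans (hT.option.add_congr (map hp hu) (map hq hv))
    (hT.option.op_comm .add o (optionRel_map hu₁ hp) (optionRel_map hu₂ hp)
      (optionRel_map hv₁ hq) (optionRel_map hv₂ hq))
  change Option.Rel T (optAdd plus _ _) (olop o (optAdd plus _ _) (optAdd plus _ _)) at key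
  rw [e, e₁, e₂, olop_some] at key
  cases key with | some key => exact hT.conv c (c₁.op o c₂) key

end Elim

/-! ### Typed proof-terms are multilinear -/

/-- Two substitutions are extensionally equal on the variables declared in `Γ`; they are
unconstrained on the others. -/
def RelCtx (Γ : Ctx) (s s' : ℕ → Tm) : Prop :=
  ∀ n A, Γ n = some A → LogEq A (s n) (s' n)

/-- At one variable declared in `Γ` the substitution `s` takes the value obtained from those of `s₁`
and `s₂` by the operation `o`; on the other variables of `Γ` the three agree. -/
def LinCtx (Γ : Ctx) (o : LOp) (s s₁ s₂ : ℕ → Tm) : Prop :=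
  ∃ n A, Γ n = some A ∧ LogEq A (s n) (lop o (s₁ n) (s₂ n)) ∧ LogEq A (s₁ n) (s₁ n) ∧
    LogEq A (s₂ n) (s₂ n) ∧
    ∀ m, m ≠ n → ∀ C, Γ m = some C → LogEq C (s m) (s₁ m) ∧ LogEq C (s m) (s₂ m)

theorem RelCtx.left {Γ : Ctx} {s s' : ℕ → Tm} (h : RelCtx Γ s s') : RelCtx Γ s s :=
  fun n A hA => (LogEq.linPER A).left (h n A hA)

theorem RelCtx.right {Γ : Ctx} {s s' : ℕ → Tm} (h : RelCtx Γ s s') : RelCtx Γ s' s' :=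
  fun n A hA => (LogEq.linPER A).right (h n A hA)

theorem Ctx.Split.left {Γ Γ₁ Γ₂ : Ctx} (h : Ctx.Split Γ Γ₁ Γ₂) {n : ℕ} {A : Prp}
    (hA : Γ₁ n = some A) : Γ n = some A := by
  rcases h n with ⟨h, -⟩ | ⟨-, h⟩ <;> simp_all

theorem Ctx.Split.right {Γ Γ₁ Γ₂ : Ctx} (h : Ctx.Split Γ Γ₁ Γ₂) {n : ℕ} {A : Prp}
    (hA : Γ₂ n = some A) : Γ n = some A := by
  rcases h n with ⟨-, h⟩ | ⟨h, -⟩ <;> simp_all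

theorem RelCtx.mono {Γ Γ' : Ctx} (h : ∀ {n A}, Γ' n = some A → Γ n = some A) {s s' : ℕ → Tm}
    (hs : RelCtx Γ s s') : RelCtx Γ' s s' :=
  fun n A hA => hs n A (h hA)

theorem RelCtx.cons {Γ : Ctx} {s s' : ℕ → Tm} {A : Prp} {u u' : Tm} (hs : RelCtx Γ s s')
    (hu : LogEq A u u') : RelCtx (Ctx.cons A Γ) (scons u s) (scons u' s') := by
  intro n C hC
  cases n with
  | zero => cases hC; exact hu
  | succ n => exact hs n C hC

theorem LinCtx.rel_left {Γ : Ctx} {o : LOp} {s s₁ s₂ : ℕ → Tm} (h : LinCtx Γ o s s₁ s₂) :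
    RelCtx Γ s s := by
  obtain ⟨n, A, hA, e, -, -, h⟩ := h
  intro m C hC
  by_cases hm : m = n
  · subst hm
    obtain rfl : A = C := by simpa [hA] using hC
    exact (LogEq.linPER A).left e
  · exact (LogEq.linPER C).left (h m hm C hC).1

theorem LinCtx.rel {Γ : Ctx} {o : LOp} {s s₁ s₂ : ℕ → Tm} (h : LinCtx Γ o s s₁ s₂) :
    RelCtx Γ s₁ s₁ ∧ RelCtx Γ s₂ s₂ := by
  obtain ⟨n, A, hA, -, e₁, e₂, h⟩ := h
  constructor <;> intro m C hC <;> by_cases hm : m = n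
  · subst hm
    obtain rfl : A = C := by simpa [hA] using hC
    exact e₁
  · exact (LogEq.linPER C).right (h m hm C hC).1
  · subst hm
    obtain rfl : A = C := by simpa [hA] using hC
    exact e₂
  · exact (LogEq.linPER C).right (h m hm C hC).2

theorem LinCtx.cons {Γ : Ctx} {o : LOp} {s s₁ s₂ : ℕ → Tm} {A : Prp} {u : Tm}
    (hs : LinCtx Γ o s s₁ s₂) (hu : LogEq A u u) :
    LinCtx (Ctx.cons A Γ) o (scons u s) (scons u s₁) (scons u s₂) := by
  obtain ⟨n, C, hC, e, e₁, e₂, h⟩ := hs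
  refine ⟨n + 1, C, hC, e, e₁, e₂, fun m hm D hD => ?_⟩
  cases m with
  | zero => cases hD; exact ⟨hu, hu⟩
  | succ m => exact h m (by simpa using hm) D hD

theorem RelCtx.linCtx {Γ : Ctx} {s : ℕ → Tm} {A : Prp} {u v : Tm} (o : LOp) (hs : RelCtx Γ s s)
    (hu : LogEq A u u) (hv : LogEq A v v) :
    LinCtx (Ctx.cons A Γ) o (scons (lop o u v) s) (scons u s) (scons v s) := by
  refine ⟨0, A, rfl, (LogEq.linPER A).op_congr o hu hv, hu, hv, fun m hm D hD => ?_⟩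
  cases m with
  | zero => exact absurd rfl hm
  | succ m => exact ⟨hs m D hD, hs m D hD⟩

/-- The distinguished variable belongs to exactly one of the two parts of a context. -/
theorem LinCtx.split {Γ Γ₁ Γ₂ : Ctx} {o : LOp} {s s₁ s₂ : ℕ → Tm} (hΓ : Ctx.Split Γ Γ₁ Γ₂)
    (h : LinCtx Γ o s s₁ s₂) :
    (LinCtx Γ₁ o s s₁ s₂ ∧ RelCtx Γ₂ s s₁ ∧ RelCtx Γ₂ s s₂) ∨
      (LinCtx Γ₂ o s s₁ s₂ ∧ RelCtx Γ₁ s s₁ ∧ RelCtx Γ₁ s s₂) := by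
  obtain ⟨n, A, hA, e, e₁, e₂, h⟩ := h
  rcases hΓ n with ⟨hn, hn'⟩ | ⟨hn, hn'⟩
  · have ne {m C} (hm : Γ₁ m = some C) : m ≠ n := by rintro rfl; simp [hn] at hm
    exact .inr ⟨⟨n, A, hn' ▸ hA, e, e₁, e₂, fun m hm C hC => h m hm C (hΓ.right hC)⟩,
      fun m C hC => (h m (ne hC) C (hΓ.left hC)).1, fun m C hC => (h m (ne hC) C (hΓ.left hC)).2⟩
  · have ne {m C} (hm : Γ₂ m = some C) : m ≠ n := by rintro rfl; simp [hn] at hm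
    exact .inl ⟨⟨n, A, hn' ▸ hA, e, e₁, e₂, fun m hm C hC => h m hm C (hΓ.left hC)⟩,
      fun m C hC => (h m (ne hC) C (hΓ.right hC)).1,
      fun m C hC => (h m (ne hC) C (hΓ.right hC)).2⟩

/-- A proof-term that respects extensional equality of its variables and is linear in each of
them. -/
structure Multilinear (Γ : Ctx) (t : Tm) (B : Prp) : Prop where
  congr {s s' : ℕ → Tm} : RelCtx Γ s s' → LogEq B (t.subst s) (t.subst s')
  linear (o : LOp) {s s₁ s₂ : ℕ → Tm} : LinCtx Γ o s s₁ s₂ →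
    LogEq B (t.subst s) (lop o (t.subst s₁) (t.subst s₂))

theorem Multilinear.inst_congr {Γ : Ctx} {t : Tm} {A B : Prp}
    (h : Multilinear (Ctx.cons A Γ) t B) {s s' : ℕ → Tm} (hs : RelCtx Γ s s') (x x' : Tm)
    (hx : LogEq A x x') :
    LogEq B ((t.subst (upSub s)).inst x) ((t.subst (upSub s')).inst x') := by
  rw [inst_subst_upSub, inst_subst_upSub]
  exact h.congr (hs.cons hx)

theorem Multilinear.inst_linear {Γ : Ctx} {t : Tm} {A B : Prp}
    (h : Multilinear (Ctx.cons A Γ) t B) (o : LOp) {s s₁ s₂ : ℕ → Tm} (hs : LinCtx Γ o s s₁ s₂)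
    (x : Tm) (hx : LogEq A x x) :
    LogEq B ((t.subst (upSub s)).inst x)
      (lop o ((t.subst (upSub s₁)).inst x) ((t.subst (upSub s₂)).inst x)) := by
  simp only [inst_subst_upSub]
  exact h.linear o (hs.cons hx)

theorem Multilinear.inst_op {Γ : Ctx} {t : Tm} {A B : Prp}
    (h : Multilinear (Ctx.cons A Γ) t B) (o : LOp) {s : ℕ → Tm} (hs : RelCtx Γ s s)
    (x y : Tm) (hx : LogEq A x x) (hy : LogEq A y y) :
    LogEq B ((t.subst (upSub s)).inst (lop o x y))
      (lop o ((t.subst (upSub s)).inst x) ((t.subst (upSub s)).inst y)) := by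
  simp only [inst_subst_upSub]
  exact h.linear o (hs.linCtx o hx hy)

theorem Multilinear.var (n : ℕ) (A : Prp) : Multilinear (Ctx.only n A) (var n) A where
  congr h := h n A (by simp [Ctx.only])
  linear o _ _ _ h := by
    obtain ⟨m, C, hC, e, -⟩ := h
    simp only [Ctx.only] at hC
    split at hC
    · subst m; cases hC; exact e
    · cases hC

theorem Multilinear.star (a : ℂ) : Multilinear Ctx.empty (star a) .one where
  congr _ := ⟨a, .refl _, .refl _⟩
  linear o _ _ _ h := by
    obtain ⟨m, C, hC, -⟩ := h
    cases hC

theorem subst_lop (s : ℕ → Tm) (o : LOp) (t u : Tm) :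
    (lop o t u).subst s = lop o (t.subst s) (u.subst s) := by
  cases o <;> rfl

/-- The premises of the rules for `+` and `•` share their context, and linearity is preserved because
the operations commute with one another. -/
theorem Multilinear.lop {Γ : Ctx} {t u : Tm} {B : Prp} (ht : Multilinear Γ t B)
    (hu : Multilinear Γ u B) (o : LOp) : Multilinear Γ (lop o t u) B where
  congr h := by
    rw [subst_lop, subst_lop]
    exact (LogEq.linPER B).op_congr o (ht.congr h) (hu.congr h)
  linear o' _ _ _ h := by
    have L := LogEq.linPER B
    simp only [subst_lop]
    exact L.trans (L.op_congr o (ht.linear o' h) (hu.linear o' h))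
      (L.op_comm o o' (ht.congr h.rel.1) (ht.congr h.rel.2) (hu.congr h.rel.1)
        (hu.congr h.rel.2))

theorem Multilinear.elimOne {Γ Γ₁ Γ₂ : Ctx} {t u : Tm} {B : Prp} (hΓ : Ctx.Split Γ Γ₁ Γ₂)
    (ht : Multilinear Γ₁ t .one) (hu : Multilinear Γ₂ u B) :
    Multilinear Γ (elimOne t u) B where
  congr h := elimOne_congr (LogEq.linPER B) (ht.congr (h.mono hΓ.left))
    (hu.congr (h.mono hΓ.right))
  linear o _ _ _ h := by
    have L := LogEq.linPER B
    rcases h.split hΓ with ⟨h, k₁, k₂⟩ | ⟨h, k₁, k₂⟩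
    · refine L.trans (elimOne_congr L (ht.linear o h) (hu.congr k₁.left)) ?_
      refine L.trans (elimOne_op_left L o (ht.congr h.rel.1) (ht.congr h.rel.2)
        (hu.congr k₁.left)) ?_
      exact L.op_congr o (elimOne_congr L (ht.congr h.rel.1) (hu.congr k₁))
        (elimOne_congr L (ht.congr h.rel.2) (hu.congr k₂))
    · refine L.trans (elimOne_congr L (ht.congr k₁.left) (hu.linear o h)) ?_
      refine L.trans (elimOne_op_right L o (ht.congr k₁.left) (hu.congr h.rel.1)
        (hu.congr h.rel.2)) ?_
      exact L.op_congr o (elimOne_congr L (ht.congr k₁) (hu.congr h.rel.1))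
        (elimOne_congr L (ht.congr k₂) (hu.congr h.rel.2))

theorem Multilinear.linFun {Γ : Ctx} {t : Tm} {A B : Prp}
    (h : Multilinear (Ctx.cons A Γ) t B) {s : ℕ → Tm} (hs : RelCtx Γ s s) :
    LinFun (LogEq A) (LogEq B) ((Tm.lam t).subst s) :=
  ⟨⟨_, .refl _⟩, fun o u v hu hv => (LogEq.linPER B).conv (.beta _ _)
    ((Conv.beta _ u).op o (.beta _ v)) (h.inst_op o hs u v hu hv)⟩

theorem Multilinear.lam {Γ : Ctx} {t : Tm} {A B : Prp}
    (h : Multilinear (Ctx.cons A Γ) t B) : Multilinear Γ (lam t) (.limp A B) := by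
  have congr {s s' : ℕ → Tm} (hs : RelCtx Γ s s') :
      LogEq (.limp A B) ((Tm.lam t).subst s) ((Tm.lam t).subst s') :=
    ⟨h.linFun hs.left, h.linFun hs.right, fun u u' hu => (LogEq.linPER B).conv (.beta _ u)
      (.beta _ u') (h.inst_congr hs u u' hu)⟩
  refine ⟨congr, fun o s s₁ s₂ hs => ?_⟩
  refine FunRel.of_pointwise (LogEq.linPER A) (LogEq.linPER B) (h.linFun hs.rel_left)
    ((LogEq.linPER (.limp A B)).op_congr o (congr hs.rel.1) (congr hs.rel.2)) fun u hu => ?_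
  refine (LogEq.linPER B).conv (.beta _ u)
    (((h.linFun hs.rel.1).app_op o (h.linFun hs.rel.2) u).trans
      ((Conv.beta _ u).op o (.beta _ u))) (h.inst_linear o hs u hu)

theorem Multilinear.app {Γ Γ₁ Γ₂ : Ctx} {t u : Tm} {A B : Prp} (hΓ : Ctx.Split Γ Γ₁ Γ₂)
    (ht : Multilinear Γ₁ t (.limp A B)) (hu : Multilinear Γ₂ u A) :
    Multilinear Γ (app t u) B where
  congr h := (ht.congr (h.mono hΓ.left)).2.2 _ _ (hu.congr (h.mono hΓ.right))
  linear o _ _ _ h := by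
    have L := LogEq.linPER B
    rcases h.split hΓ with ⟨h, k₁, k₂⟩ | ⟨h, k₁, k₂⟩
    · have h₁ := ht.congr h.rel.1
      have h₂ := ht.congr h.rel.2
      exact L.trans ((ht.linear o h).2.2 _ _ (hu.congr k₁.left))
        (L.conv (h₁.1.app_op o h₂.1 _) (.refl _)
          (L.op_congr o (h₁.2.2 _ _ (hu.congr k₁)) (h₂.2.2 _ _ (hu.congr k₂))))
    · have h₀ := ht.congr k₁.left
      have h₁ := hu.congr h.rel.1
      have h₂ := hu.congr h.rel.2
      exact L.trans (h₀.2.2 _ _ (hu.linear o h)) (L.trans (h₀.1.2 o _ _ h₁ h₂)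
        (L.op_congr o ((ht.congr k₁).2.2 _ _ h₁) ((ht.congr k₂).2.2 _ _ h₂)))

theorem logEq_inl {t t' : Tm} {A B : Prp} (h : LogEq A t t') :
    LogEq (.oplus A B) (inl t) (inl t') :=
  ⟨some t, none, some t', none, by simp, .refl _, .refl _, .some h, .none⟩

theorem logEq_inr {t t' : Tm} {A B : Prp} (h : LogEq B t t') :
    LogEq (.oplus A B) (inr t) (inr t') :=
  ⟨none, some t, none, some t', by simp, .refl _, .refl _, .none, .some h⟩

theorem logEq_inlr {t t' u u' : Tm} {A B : Prp} (h : LogEq A t t') (k : LogEq B u u') :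
    LogEq (.oplus A B) (inlr t u) (inlr t' u') :=
  ⟨some t, some u, some t', some u', by simp, .refl _, .refl _, .some h, .some k⟩

theorem Multilinear.inl {Γ : Ctx} {t : Tm} {A B : Prp} (h : Multilinear Γ t A) :
    Multilinear Γ (inl t) (.oplus A B) where
  congr hs := logEq_inl (h.congr hs)
  linear o _ _ _ hs := by
    refine (LogEq.linPER _).conv (.refl _) ?_ (logEq_inl (h.linear o hs))
    cases o with
    | add => exact (RootStep.plusInlInl _ _).conv_plus
    | smul a => exact (RootStep.scalInl _ _).conv_scal

theorem Multilinear.inr {Γ : Ctx} {t : Tm} {A B : Prp} (h : Multilinear Γ t B) :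
    Multilinear Γ (inr t) (.oplus A B) where
  congr hs := logEq_inr (h.congr hs)
  linear o _ _ _ hs := by
    refine (LogEq.linPER _).conv (.refl _) ?_ (logEq_inr (h.linear o hs))
    cases o with
    | add => exact (RootStep.plusInrInr _ _).conv_plus
    | smul a => exact (RootStep.scalInr _ _).conv_scal

theorem Multilinear.inlr {Γ : Ctx} {t u : Tm} {A B : Prp} (h : Multilinear Γ t A)
    (k : Multilinear Γ u B) : Multilinear Γ (inlr t u) (.oplus A B) where
  congr hs := logEq_inlr (h.congr hs) (k.congr hs)
  linear o _ _ _ hs := by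
    refine (LogEq.linPER _).conv (.refl _) ?_ (logEq_inlr (h.linear o hs) (k.linear o hs))
    cases o with
    | add => exact (RootStep.plusInlrInlr _ _ _ _).conv_plus
    | smul a => exact (RootStep.scalInlr _ _ _).conv_scal

theorem Multilinear.elimPlus {Γ Γ₁ Γ₂ : Ctx} {t u v : Tm} {A B C : Prp}
    (hΓ : Ctx.Split Γ Γ₁ Γ₂) (ht : Multilinear Γ₁ t (.oplus A B))
    (hu : Multilinear (Ctx.cons A Γ₂) u C) (hv : Multilinear (Ctx.cons B Γ₂) v C) :
    Multilinear Γ (elimPlus t u v) C := by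
  have LA := LogEq.linPER A
  have LB := LogEq.linPER B
  have L := LogEq.linPER C
  have congr {s s' : ℕ → Tm} {t t' : Tm} (h : LogEq (.oplus A B) t t') (k : RelCtx Γ₂ s s') :
      LogEq C (Tm.elimPlus t (u.subst (upSub s)) (v.subst (upSub s)))
        (Tm.elimPlus t' (u.subst (upSub s')) (v.subst (upSub s'))) :=
    elimPlus_congr L h (hu.inst_congr k) (hv.inst_congr k)
  refine ⟨fun h => congr (ht.congr (h.mono hΓ.left)) (h.mono hΓ.right),
    fun o s s₁ s₂ h => ?_⟩
  rcases h.split hΓ with ⟨h, k₁, k₂⟩ | ⟨h, k₁, k₂⟩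
  · have h₁ := ht.congr h.rel.1
    have h₂ := ht.congr h.rel.2
    have k := k₁.left
    exact L.trans (congr (ht.linear o h) k)
      (L.trans (elimPlus_op_left LA LB L o h₁ h₂ (hu.inst_congr k) (hv.inst_congr k)
        (hu.inst_op o k) (hv.inst_op o k)) (L.op_congr o (congr h₁ k₁) (congr h₂ k₂)))
  · exact L.trans (elimPlus_op_right LA LB L o (ht.congr k₁.left) (hu.inst_linear o h)
      (hv.inst_linear o h) (hu.inst_congr h.rel.1) (hu.inst_congr h.rel.2)
      (hv.inst_congr h.rel.1) (hv.inst_congr h.rel.2))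
      (L.op_congr o (congr (ht.congr k₁) h.rel.1) (congr (ht.congr k₂) h.rel.2))

/-- The fundamental theorem of the logical relation. -/
theorem HasType.multilinear {Γ : Ctx} {t : Tm} {A : Prp} (h : HasType Γ t A) (hn : t.NDFree) :
    Multilinear Γ t A := by
  induction h with
  | ax n A => exact .var n A
  | sum _ _ i j => exact (i hn.1).lop (j hn.2) .add
  | prod a _ i => exact (i hn).lop (i hn) (.smul a)
  | oneI a => exact .star a
  | oneE hΓ _ _ i j => exact (i hn.1).elimOne hΓ (j hn.2)
  | limpI _ i => exact (i hn).lam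
  | limpE hΓ _ _ i j => exact (i hn.1).app hΓ (j hn.2)
  | oplusI1 _ i => exact (i hn).inl
  | oplusI2 _ i => exact (i hn).inr
  | oplusI3 _ _ i j => exact (i hn.1).inlr (j hn.2)
  | oplusE hΓ _ _ _ i j k => exact (i hn.1).elimPlus hΓ (j hn.2.1) (k hn.2.2)
  | oplusEND => exact hn.elim

/-! ### Normal forms of vector propositions -/

theorem Step.of_par {t t' : Tm} (h : Par t t') : ReflTransGen Step t t' := by
  have lift {f : Tm → Tm} (hf : ∀ {t t'}, Step t t' → Step (f t) (f t')) {t t' : Tm}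
      (h : ReflTransGen Step t t') : ReflTransGen Step (f t) (f t') :=
    h.lift f fun _ _ => hf
  induction h with
  | var n => exact .refl
  | star a => exact .refl
  | plus _ _ i j => exact (lift .plus₁ i).trans (lift .plus₂ j)
  | scal a _ i => exact lift .scal i
  | elimOne _ _ i j => exact (lift .elimOne₁ i).trans (lift .elimOne₂ j)
  | lam _ i => exact lift .lam i
  | app _ _ i j => exact (lift .app₁ i).trans (lift .app₂ j)
  | inl _ i => exact lift .inl i
  | inr _ i => exact lift .inr i
  | inlr _ _ i j => exact (lift .inlr₁ i).trans (lift .inlr₂ j)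
  | elimPlus _ _ _ i j k =>
    exact (lift .elimPlus₁ i).trans ((lift .elimPlus₂ j).trans (lift .elimPlus₃ k))
  | elimPlusND _ _ _ i j k =>
    exact (lift .elimPlusND₁ i).trans ((lift .elimPlusND₂ j).trans (lift .elimPlusND₃ k))
  | plusRoot _ _ r i j => exact ((lift .plus₁ i).trans (lift .plus₂ j)).tail (.root r)
  | scalRoot _ r i => exact (lift .scal i).tail (.root r)
  | elimOneRoot _ _ r i j =>
    exact ((lift .elimOne₁ i).trans (lift .elimOne₂ j)).tail (.root r)
  | appRoot _ _ r i j => exact ((lift .app₁ i).trans (lift .app₂ j)).tail (.root r)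
  | elimPlusRoot _ _ _ r i j k =>
    exact ((lift .elimPlus₁ i).trans ((lift .elimPlus₂ j).trans (lift .elimPlus₃ k))).tail
      (.root r)

theorem Step.of_par_star {t t' : Tm} (h : ReflTransGen Par t t') : ReflTransGen Step t t' := by
  induction h with
  | refl => exact .refl
  | tail _ h i => exact i.trans (Step.of_par h)

theorem Irred.eq {n m : Tm} (hn : Irred n) (h : ReflTransGen Step n m) : m = n := by
  rcases h.cases_head with rfl | ⟨_, h, -⟩
  · rfl
  · exact (hn _ h).elim

theorem RootStep.par {t r : Tm} (h : RootStep t r) (hn : t.NDFree) : Par t r := by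
  cases h with
  | one => exact .elimOneRoot (.refl _) (.refl _) (by constructor)
  | beta => exact .appRoot (.refl _) (.refl _) (by constructor)
  | caseInl | caseInr | caseInlr =>
    exact .elimPlusRoot (.refl _) (.refl _) (.refl _) (by constructor)
  | ndInl | ndInr | ndInlrLeft | ndInlrRight => exact hn.elim
  | scalStar | scalLam | scalInl | scalInr | scalInlr =>
    exact .scalRoot (.refl _) (by constructor)
  | _ => exact .plusRoot (.refl _) (.refl _) (by constructor)

/-- Conversion leaves out the non-deterministic rules, but without the symbol they never apply. -/
theorem Step.par {t r : Tm} (h : Step t r) (hn : t.NDFree) : Par t r := by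
  induction h with
  | root h => exact h.par hn
  | plus₁ _ i => exact .plus (i hn.1) (.refl _)
  | plus₂ _ i => exact .plus (.refl _) (i hn.2)
  | scal _ i => exact .scal _ (i hn)
  | elimOne₁ _ i => exact .elimOne (i hn.1) (.refl _)
  | elimOne₂ _ i => exact .elimOne (.refl _) (i hn.2)
  | lam _ i => exact .lam (i hn)
  | app₁ _ i => exact .app (i hn.1) (.refl _)
  | app₂ _ i => exact .app (.refl _) (i hn.2)
  | inl _ i => exact .inl (i hn)
  | inr _ i => exact .inr (i hn)
  | inlr₁ _ i => exact .inlr (i hn.1) (.refl _)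
  | inlr₂ _ i => exact .inlr (.refl _) (i hn.2)
  | elimPlus₁ _ i => exact .elimPlus (i hn.1) (.refl _) (.refl _)
  | elimPlus₂ _ i => exact .elimPlus (.refl _) (i hn.2.1) (.refl _)
  | elimPlus₃ _ i => exact .elimPlus (.refl _) (.refl _) (i hn.2.2)
  | elimPlusND₁ | elimPlusND₂ | elimPlusND₃ => exact hn.elim

theorem Tm.NDFree.rename {t : Tm} (h : t.NDFree) (f : ℕ → ℕ) : (t.rename f).NDFree := by
  induction t generalizing f <;> simp_all [Tm.rename, NDFree]

theorem Tm.NDFree.subst {t : Tm} (h : t.NDFree) {s : ℕ → Tm} (hs : ∀ n, (s n).NDFree) :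
    (t.subst s).NDFree := by
  have up {s : ℕ → Tm} (hs : ∀ n, (s n).NDFree) (n : ℕ) : (upSub s n).NDFree := by
    cases n with
    | zero => trivial
    | succ n => exact (hs n).rename _
  induction t generalizing s <;> simp_all [Tm.subst, NDFree]

theorem Tm.NDFree.inst {t u : Tm} (h : t.NDFree) (hu : u.NDFree) : (t.inst u).NDFree := by
  refine h.subst fun n => ?_
  cases n with
  | zero => exact hu
  | succ n => trivial

theorem RootStep.ndFree {t r : Tm} (h : RootStep t r) (hn : t.NDFree) : r.NDFree := by
  cases h <;> simp_all [NDFree, NDFree.inst]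

theorem Step.ndFree {t r : Tm} (h : Step t r) (hn : t.NDFree) : r.NDFree := by
  induction h with
  | root h => exact h.ndFree hn
  | _ => simp_all [NDFree]

theorem Conv.of_step_star {t r : Tm} (h : ReflTransGen Step t r) (hn : t.NDFree) :
    Conv t r ∧ r.NDFree := by
  induction h with
  | refl => exact ⟨.refl _, hn⟩
  | tail _ h i => exact ⟨i.1.trans (h.par i.2).conv, h.ndFree i.2⟩

/-- By the Church–Rosser property, an irreducible proof-term convertible to `t` is its one and only
normal form. -/
theorem isNormalForm_iff_of_conv {t n : Tm} (ht : t.NDFree) (h : Conv t n) (hn : Irred n)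
    (m : Tm) : IsNormalForm t m ↔ m = n := by
  have joins {t n : Tm} (h : Conv t n) (hn : Irred n) : ReflTransGen Step t n := by
    obtain ⟨r, p, q⟩ := h
    obtain rfl := hn.eq (Step.of_par_star q)
    exact Step.of_par_star p
  constructor
  · rintro ⟨hm, im⟩
    exact (im.eq (joins ((Conv.of_step_star hm ht).1.symm.trans h) hn)).symm
  · rintro rfl
    exact ⟨joins h hn, hn⟩

theorem irred_star (a : ℂ) : Irred (star a) := by
  rintro _ (h | _)
  cases h

theorem Irred.inl {t : Tm} (h : Irred t) : Irred (inl t) := by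
  intro _ k
  cases k with
  | root k => cases k
  | inl k => exact h _ k

theorem Irred.inr {t : Tm} (h : Irred t) : Irred (inr t) := by
  intro _ k
  cases k with
  | root k => cases k
  | inr k => exact h _ k

theorem Irred.inlr {t u : Tm} (h : Irred t) (h' : Irred u) : Irred (inlr t u) := by
  intro _ k
  cases k with
  | root k => cases k
  | inlr₁ k => exact h _ k
  | inlr₂ k => exact h' _ k

/-- At a vector proposition, extensional equality is equality of normal forms: no implication
remains under which two different normal forms could behave alike. -/
theorem LogEq.exists_irred {B : Prp} (hB : IsVec B) {t t' : Tm} (h : LogEq B t t') :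
    ∃ n, Irred n ∧ Conv t n ∧ Conv t' n := by
  induction hB generalizing t t' with
  | one =>
    obtain ⟨a, h, k⟩ := h
    exact ⟨star a, irred_star a, h, k⟩
  | oplus _ _ i j =>
    obtain ⟨p, q, p', q', hn, h, k, hp, hq⟩ := h
    cases hp with
    | none =>
      cases hq with
      | none => simp at hn
      | some hq =>
        obtain ⟨n, hn, c, d⟩ := j hq
        exact ⟨_, hn.inr, h.trans c.inr, k.trans d.inr⟩
    | some hp =>
      obtain ⟨m, hm, e, f⟩ := i hp
      cases hq with
      | none => exact ⟨_, hm.inl, h.trans e.inl, k.trans f.inl⟩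
      | some hq =>
        obtain ⟨n, hn, c, d⟩ := j hq
        exact ⟨_, hm.inlr hn, h.trans (e.inlr c), k.trans (f.inlr d)⟩

theorem LogEq.nfEq {B : Prp} (hB : IsVec B) {t t' : Tm} (h : LogEq B t t') (ht : t.NDFree)
    (ht' : t'.NDFree) : NFEq t t' := by
  obtain ⟨n, hn, c, d⟩ := h.exists_irred hB
  exact ⟨n, isNormalForm_iff_of_conv ht c hn, isNormalForm_iff_of_conv ht' d hn⟩

theorem HasType.logEq_self {u : Tm} {A : Prp} (h : HasType Ctx.empty u A) (hn : u.NDFree) :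
    LogEq A u u := by
  simpa only [subst_var] using (h.multilinear hn).congr (s := var) (s' := var) nofun

theorem HasType.inst_op {A B : Prp} {t : Tm} (ht : HasType (Ctx.cons A Ctx.empty) t B)
    (htn : t.NDFree) (o : LOp) {u v : Tm} (hu : LogEq A u u) (hv : LogEq A v v) :
    LogEq B (t.inst (lop o u v)) (lop o (t.inst u) (t.inst v)) := by
  have := (ht.multilinear htn).inst_op o (s := var) nofun u v hu hv
  simpa only [upSub_var, subst_var] using this

end QILR

theorem mainTheorem8 (A B : QILR.Prp) (hB : QILR.IsVec B)
    (t : QILR.Tm) (ht : QILR.HasType (QILR.Ctx.cons A QILR.Ctx.empty) t B) (htn : t.NDFree)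
    (u₁ u₂ : QILR.Tm)
    (hu₁ : QILR.HasType QILR.Ctx.empty u₁ A) (hu₁n : u₁.NDFree)
    (hu₂ : QILR.HasType QILR.Ctx.empty u₂ A) (hu₂n : u₂.NDFree) :
    QILR.NFEq (t.inst (QILR.Tm.plus u₁ u₂)) (QILR.Tm.plus (t.inst u₁) (t.inst u₂)) ∧
    ∀ a : ℂ, QILR.NFEq (t.inst (QILR.Tm.scal a u₁)) (QILR.Tm.scal a (t.inst u₁)) := by
  have h₁ := hu₁.logEq_self hu₁n
  have h₂ := hu₂.logEq_self hu₂n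
  exact ⟨(ht.inst_op htn .add h₁ h₂).nfEq hB (htn.inst ⟨hu₁n, hu₂n⟩)
      ⟨htn.inst hu₁n, htn.inst hu₂n⟩,
    fun a => (ht.inst_op htn (.smul a) h₁ h₁).nfEq hB (htn.inst (u := .scal a u₁) hu₁n)
      (htn.inst hu₁n)⟩
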